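/- Let $A\in M_{m\times m}(\mathbb C)$, $B\in M_{n\times n}(\mathbb C)$ and let $\varphi_{AB}(X)=AX-XB$ on $M_{m\times n}(\mathbb C)$. **Conventions.** For a linear operator $f$ on a finite-dimensional complex space and $z\in\mathbb C$ put $\nu_k=\dim\ker(f-zI)^k$ (so $\nu_0=0$). The index of $z$ is the least $q\ge 1$ with $\nu_q=\nu_{q+1}$, and the Weyr characteristic of $f$ at $z$ is $\omega(f,z)=(\omega_1,\dots,\omega_q)$ with $\omega_k=\nu_k-\nu_{k-1}$; put $\omega_k=0$ for $k>q$. Let $\lambda_1,\dots,\lambda_a$ be the distinct eigenvalues of $A$ and $\mu_1,\dots,\mu_b$ those of $B$, with indices $p_i$, $q_j$ and Weyr characteristics $\alpha_i=(\alpha_{i1},\dots,\alpha_{ip_i})=\omega(A,\lambda_i)$, $\beta_j=(\beta_{j1},\dots,\beta_{jq_j})=\omega(B,\mu_j)$, where $\alpha_{i,l}=0$ for $l>p_i$ and $\beta_{j,l}=0$ for $l>q_j$. For $\gamma=(\gamma_1\ge\dots\ge\gamma_p\ge 1)$ let $N_\gamma$ be the $p\times p$ block matrix with diagonal blocks of sizes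 $\gamma_1,\dots,\gamma_p$ whose block $(c,c+1)$ is $\binom{I_{\gamma_{c+1}}}{0}$ and whose other blocks are $0$. Let $W_A=\bigoplus_i(\lambda_iI+N_{\alpha_i})$, $W_B=\bigoplus_j(\mu_jI+N_{\beta_j})$, and write $\varphi_{\alpha_i\beta_j}=\varphi_{N_{\alpha_i}N_{\beta_j}}$. Let $e_{uv}$ denote a matrix unit, taken to be $0$ if $(u,v)$ is out of range. For a matrix $Z$, let $E_{cd}(\gamma,\delta)\boxtimes Z$ be the block matrix of type $(\gamma,\delta)$ (block $(c',d')$ has size $\gamma_{c'}\times\delta_{d'}$) whose only nonzero block is block $(c,d)$, which agrees with $Z$ on their common upper left part and is $0$ elsewhere. For a matrix $Y$ of size $|\alpha_i|\times|\beta_j|$, where $|\alpha_i|=\sum_l\alpha_{il}$ and $|\beta_j|=\sum_l\beta_{jl}$, let $E_{ij}(\alpha,\beta)\boxtimes Y$ be the matrix partitioned conformally with $W_A$, $W_B$ with block $(i,j)$ equal to $Y$ and other blocks $0$. **Dimensions.** For every integer $k\ge 1$, $$\dim\ker\varphi_{AB}^k=\sum_{i=1}^a\sum_{j=1}^b\delta_{\lambda_i,\mu_j}\dim\ker\varphi_{\alpha_i\beta_j}^k$$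 $$=\sum_{i=1}^a\sum_{j=1}^b\delta_{\lambda_i,\mu_j}\Big(\sum_{r=2}^k\sum_{l=0}^{\min\{p_i,q_j\}}\alpha_{i,r+l}(\beta_{j,1+l}-\beta_{j,2+k-r+l})+\sum_{l=0}^{\min\{p_i,q_j\}}\alpha_{i,1+l}\sum_{s=1}^k\beta_{j,s+l}\Big).$$ **Basis.** Fix $k\ge1$. Call $(i,j,r,s,l)$ admissible if $\lambda_i=\mu_j$ and either $s=1$, $2\le r\le\min\{p_i,k\}$, $0\le l\le\min\{p_i-r,q_j-1\}$, or $r=1$, $1\le s\le q_j$, $0\le l\le\min\{p_i-1,q_j-s\}$. With $N_p=e_{12}+\dots+e_{p-1,p}$ of size $p\times p$, consider for $Q\ge q_j$ the equation in $M_{p_i\times Q}(\mathbb C)$, with $\varphi=\varphi_{N_{p_i}N_Q}$, $$\varphi^{k-1}\Big(\sum_{t=0}^l x_te_{r+t,s+t}\Big)=\sum_{t=0}^l e_{1+t,k-r+s+t}+\sum_{t>l}y_te_{1+t,k-r+s+t}\ \text{ for some numbers } y_t.\tag{$*$}$$ For admissible $(i,j,r,s,l)$ and every $Q\ge q_j$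 with $k+l+s\le Q+r$ (so $Q=q_j$ is permitted whenever $k+l+s\le q_j+r$), there is exactly one $(x_0,\dots,x_l)$ satisfying $(*)$. For each admissible $(i,j,r,s,l)$ take the solution $(x_{k0},\dots,x_{kl})$ of $(*)$ for any such $Q$. Then the matrices $$E_{ij}(\alpha,\beta)\boxtimes\Big(\sum_{t=0}^l x_{kt}\,E_{r+t,s+t}(\alpha_i,\beta_j)\boxtimes e_{uv}\Big),\qquad e_{uv}\in M_{\alpha_{i,r+l}\times\beta_{j,s+l}}(\mathbb C),$$ where $(i,j,r,s,l)$ runs over the admissible tuples and $1\le u\le\alpha_{i,r+l}$, $\beta_{j,1+k-r+s+l}+1\le v\le\beta_{j,s+l}$, form a basis of $\ker\varphi_{W_AW_B}^k$. **Eigenvalues and Weyr characteristics.** The set of eigenvalues of $\varphi_{AB}$ is $\{\lambda_i-\mu_j\mid 1\le i\le a,\ 1\le j\le b\}$. If $\lambda$ is an eigenvalue of $\varphi_{AB}$ and $\omega=(\omega_1,\dots,\omega_q)$ is the Weyr characteristic of $\varphi_{AB}$ at $\lambda$, then for all $k\ge1$ $$\omega_k=\sum_{i=1}^a\sum_{j=1}^b\delta_{\lambda_i-\lambda,\mu_j}\sum_{l=0}^{\min\{p_i,q_j\}}\Big(\alpha_{i,1+l}\beta_{j,k+l}+\sum_{r=2}^k\alpha_{i,r+l}(\beta_{j,1+k-r+l}-\beta_{j,2+k-r+l})\Big),$$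 and the index $q$ of $\lambda$ equals $\max\{p_i+q_j-1\mid\lambda_i-\mu_j=\lambda\}$. **Similarity.** For all $C\in M_{m\times m}(\mathbb C)$ and $D\in M_{n\times n}(\mathbb C)$, the operators $\varphi_{AB}$ and $\varphi_{CD}$ are similar if and only if $\dim\ker\varphi_{A-\lambda I,B}^k=\dim\ker\varphi_{C-\lambda I,D}^k$ for every eigenvalue $\lambda$ of $\varphi_{AB}$ and every $1\le k\le mn$. -/

import Mathlib

noncomputable section

namespace WeyrKernel

/-- The operator `X ↦ A X - X B` on `m × n` complex matrices. -/
def phi {m n : Type*} [Fintype m] [Fintype n]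
    (A : Matrix m m ℂ) (B : Matrix n n ℂ) : Module.End ℂ (Matrix m n ℂ) where
  toFun X := A * X - X * B
  map_add' X Y := by rw [Matrix.mul_add, Matrix.add_mul]; abel
  map_smul' c X := by simp [smul_sub]

/-- `nullity (f - z I) ^ k`. -/
def nullity {V : Type*} [AddCommGroup V] [Module ℂ V] (f : Module.End ℂ V) (z : ℂ) (k : ℕ) : ℕ :=
  Module.finrank ℂ (LinearMap.ker ((f - z • (1 : Module.End ℂ V)) ^ k))

/-- The index of `z`: the smallest positive `q` with
`nullity (f - z I) ^ q = nullity (f - z I) ^ (q + 1)`. -/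
def weyrIndex {V : Type*} [AddCommGroup V] [Module ℂ V] (f : Module.End ℂ V) (z : ℂ) : ℕ :=
  sInf {q : ℕ | 0 < q ∧ nullity f z q = nullity f z (q + 1)}

/-- The Weyr characteristic `(ω₁, …, ω_q)` of `f` at `z`, `q` being the index of `z`, as a sequence
with 1-based positions, extended by `0` beyond position `q`. The nullities increase with the power,
so the subtraction is not truncated. -/
def weyrChar {V : Type*} [AddCommGroup V] [Module ℂ V] (f : Module.End ℂ V) (z : ℂ) (k : ℕ) : ℕ :=
  if k ≤ weyrIndex f z then nullity f z k - nullity f z (k - 1) else 0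

/-- Row (or column) positions of a matrix partitioned by `(γ 1, …, γ p)`: a block number and a
position in that block. Both are stored 0-based, so block `c : Fin p` has size `γ (c + 1)`. -/
abbrev BlockIdx (p : ℕ) (γ : ℕ → ℕ) : Type := Σ c : Fin p, Fin (γ (c + 1))

/-- The nilpotent Weyr matrix `N_γ` of Weyr characteristic `γ = (γ 1, …, γ p)`: the block in
position `(c, c + 1)` is the identity on top of zero rows, all other blocks are zero. -/
def weyrNilpotent (p : ℕ) (γ : ℕ → ℕ) : Matrix (BlockIdx p γ) (BlockIdx p γ) ℂ :=
  Matrix.of fun x y =>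
    if (y.1 : ℕ) = (x.1 : ℕ) + 1 ∧ (x.2 : ℕ) = (y.2 : ℕ) then 1 else 0

/-- The Weyr matrix with eigenvalues `lam i` of Weyr characteristics `(α i 1, …, α i (p i))`:
the direct sum of the Weyr blocks `lam i • 1 + N_{α i}`. -/
def weyrMatrix {a : ℕ} (lam : Fin a → ℂ) (p : Fin a → ℕ) (α : Fin a → ℕ → ℕ) :
    Matrix (Σ i : Fin a, BlockIdx (p i) (α i)) (Σ i : Fin a, BlockIdx (p i) (α i)) ℂ :=
  Matrix.blockDiagonal' fun i =>
    lam i • (1 : Matrix (BlockIdx (p i) (α i)) (BlockIdx (p i) (α i)) ℂ) +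
      weyrNilpotent (p i) (α i)

/-- The `K × L` matrix unit `e_{uv}`, with 1-based `u`, `v`; it is zero outside the range. -/
def matUnit (K L u v : ℕ) : Matrix (Fin K) (Fin L) ℂ :=
  Matrix.of fun x y => if (x : ℕ) + 1 = u ∧ (y : ℕ) + 1 = v then 1 else 0

/-- `E_{cd}(γ, δ) ⊠ Z`, with 1-based `c`, `d`: the block matrix of type `(γ, δ)` whose only
nonzero block is block `(c, d)`, which agrees with `Z` on their common upper left part and is zero
elsewhere. -/
def blockBox (p q : ℕ) (γ δ : ℕ → ℕ) (c d : ℕ) {K L : ℕ} (Z : Matrix (Fin K) (Fin L) ℂ) :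
    Matrix (BlockIdx p γ) (BlockIdx q δ) ℂ :=
  Matrix.of fun x y =>
    if (x.1 : ℕ) + 1 = c ∧ (y.1 : ℕ) + 1 = d then
      if h : (x.2 : ℕ) < K ∧ (y.2 : ℕ) < L then Z ⟨x.2, h.1⟩ ⟨y.2, h.2⟩ else 0
    else 0

/-- `E_{ij}(α, β) ⊠ Y` for a matrix `Y` of exactly the size of block `(i, j)`. -/
def outerBox {a b : ℕ} {R : Fin a → Type} {C : Fin b → Type} (i : Fin a) (j : Fin b)
    (Y : Matrix (R i) (C j) ℂ) : Matrix (Σ i, R i) (Σ j, C j) ℂ :=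
  Matrix.of fun x y =>
    if hx : x.1 = i then
      if hy : y.1 = j then Y (hx ▸ x.2) (hy ▸ y.2) else 0
    else 0

/-- The nilpotent Jordan block `e₁₂ + e₂₃ + ⋯ + e_{p-1,p}`. -/
def jordanNilpotent (p : ℕ) : Matrix (Fin p) (Fin p) ℂ :=
  ∑ c ∈ Finset.Icc 1 (p - 1), matUnit p p c (c + 1)

/-- `(x₀, …, x_l)` satisfies, in the `p × Q` matrices and for suitable numbers `y_t`,
`φ^K (∑_{t ≤ l} x_t e_{r+t,s+t})
  = ∑_{t ≤ l} e_{1+t,K-r+1+s+t} + ∑_{t > l} y_t e_{1+t,K-r+1+s+t}`,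
where `φ X = N_p X - X N_Q`; used for `1 ≤ r ≤ K + 1`. (For `t ≥ p` the matrix unit
`e_{1+t,·}` is zero.) -/
def SolvesCoeff (p Q K r s l : ℕ) (x : Fin (l + 1) → ℂ) : Prop :=
  ∃ y : ℕ → ℂ,
    (phi (jordanNilpotent p) (jordanNilpotent Q) ^ K)
        (∑ t : Fin (l + 1), x t • matUnit p Q (r + t) (s + t)) =
      ∑ t : Fin (l + 1), matUnit p Q (1 + t) (K + 1 - r + s + t) +
        ∑ t ∈ Finset.Ioo l p, y t • matUnit p Q (1 + t) (K + 1 - r + s + t)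

/-- The range of `(r, s, l)` for a `p × q` block structure and the power `k`. -/
def AdmissibleRSL (p q k r s l : ℕ) : Prop :=
  (2 ≤ r ∧ r ≤ min p k ∧ s = 1 ∧ l ≤ min (p - r) (q - 1)) ∨
  (r = 1 ∧ 1 ≤ s ∧ s ≤ q ∧ l ≤ min (p - 1) (q - s))

/-- Labels `(i, j, r, s, l, u, v)` of candidate basis elements. -/
structure Label (a b : ℕ) where
  i : Fin a
  j : Fin b
  r : ℕ
  s : ℕ
  l : ℕ
  u : ℕ
  v : ℕ

/-- The labels that occur in the basis of the kernel of the `k`-th power. -/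
def labelSet {a b : ℕ} (lam : Fin a → ℂ) (mu : Fin b → ℂ) (p : Fin a → ℕ) (q : Fin b → ℕ)
    (α : Fin a → ℕ → ℕ) (β : Fin b → ℕ → ℕ) (k : ℕ) : Set (Label a b) :=
  {L | lam L.i = mu L.j ∧ AdmissibleRSL (p L.i) (q L.j) k L.r L.s L.l ∧
    1 ≤ L.u ∧ L.u ≤ α L.i (L.r + L.l) ∧
    β L.j (1 + k - L.r + L.s + L.l) + 1 ≤ L.v ∧ L.v ≤ β L.j (L.s + L.l)}

/-- The matrix
`E_{ij}(α, β) ⊠ (∑_{t ≤ l} x_t E_{r+t,s+t}(α_i, β_j) ⊠ e_{uv})`, where `e_{uv}` has size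
`α_{i,r+l} × β_{j,s+l}` and `x` may depend on `i, j, r, s, l`. -/
def kernelElement {a b : ℕ} (p : Fin a → ℕ) (q : Fin b → ℕ)
    (α : Fin a → ℕ → ℕ) (β : Fin b → ℕ → ℕ)
    (x : Fin a → Fin b → ℕ → ℕ → (l : ℕ) → Fin (l + 1) → ℂ) (L : Label a b) :
    Matrix (Σ i : Fin a, BlockIdx (p i) (α i)) (Σ j : Fin b, BlockIdx (q j) (β j)) ℂ :=
  outerBox (R := fun i => BlockIdx (p i) (α i)) (C := fun j => BlockIdx (q j) (β j)) L.i L.j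
    (∑ t : Fin (L.l + 1), x L.i L.j L.r L.s L.l t •
      blockBox (p L.i) (q L.j) (α L.i) (β L.j) (L.r + t) (L.s + t)
        (matUnit (α L.i (L.r + L.l)) (β L.j (L.s + L.l)) L.u L.v))

/-- The number `d_k` attached to the sequences `γ = (γ 1, …, γ p)` and `δ = (δ 1, …, δ q)`. -/
def dimNumber (p q : ℕ) (γ δ : ℕ → ℕ) (k : ℕ) : ℤ :=
  ∑ r ∈ Finset.Icc 2 k, ∑ l ∈ Finset.range (min p q + 1),
      (γ (r + l) : ℤ) * ((δ (1 + l) : ℤ) - (δ (2 + k - r + l) : ℤ)) +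
    ∑ l ∈ Finset.range (min p q + 1),
      (γ (1 + l) : ℤ) * ∑ s ∈ Finset.Icc 1 k, (δ (s + l) : ℤ)

/-- The number giving the contribution of `γ` and `δ` to the `k`-th Weyr number. -/
def weyrNumber (p q : ℕ) (γ δ : ℕ → ℕ) (k : ℕ) : ℤ :=
  ∑ l ∈ Finset.range (min p q + 1),
    ((γ (1 + l) : ℤ) * (δ (k + l) : ℤ) +
      ∑ r ∈ Finset.Icc 2 k,
        (γ (r + l) : ℤ) * ((δ (1 + k - r + l) : ℤ) - (δ (2 + k - r + l) : ℤ)))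

/-- Similarity of two operators on the same space. -/
def SimilarOps {V : Type*} [AddCommGroup V] [Module ℂ V] (f g : Module.End ℂ V) : Prop :=
  ∃ T : V ≃ₗ[ℂ] V, ∀ v, T (f v) = g (T v)

end WeyrKernel

end

noncomputable section

namespace WeyrKernel

/-! Conjugating `A` and `B` to Weyr form turns `phi A B` into an operator on arrays of entries, one
for each row chain `(i, u)` and column chain `(j, v)` of standard vectors. On such an array it acts
as `shiftOp w` with `w = lam i - mu j`. If `w ≠ 0` this is injective, so only pairs with `lam i = mu
j` meet the kernel. If `w = 0`, each diagonal of the array is a polynomial `S`, and the `k`-th power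
of the operator multiplies it by `(1 - z) ^ k`, with only a window of coefficients visible inside
the array.

Everything then rests on `eq_zero_of_gap`: a polynomial of degree below `l` vanishes if its product
with `(1 - z) ^ K` has `l` consecutive zero coefficients starting at a position at most `K`. Such a
product would have at most `K` monomials and a zero of order `K` at `1`. This gives unique
solvability of the coefficient system (`existsUnique_solvesWindow`), nonvanishing of the last
coefficient (`SolvesWindow.last_ne_zero`), and the fact that a kernel element is determined by its
entries at the leading positions of the labels (`eq_zero_of_leadingEntry`). The nonzero last
coefficients make the candidates independent, and the leading entries embed the kernel in a space of
the same dimension, so the candidates form a basis. Counting labels gives the dimension formula.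

Differences of consecutive dimensions give the Weyr characteristic. All its contributions are
nonnegative, and the last nonzero one of the pair `(i, j)` is at `p i + q j - 1`, whence the
eigenvalues and the index. Similarity reduces to the existence of the Weyr form for an arbitrary
operator, built from an adapted basis of the flag `ker g ∩ range (g ^ k)`: nullities determine that
form. -/

/-! ### Sparse polynomials and zeros at 1 -/

open Polynomial in
/-- A polynomial with at most `K` monomials and a zero of order `K` at `1` vanishes. -/
theorem eq_zero_of_card_support_le (K : ℕ) (P : ℂ[X]) (hP : P.support.card ≤ K)
    (hdvd : (X - C 1) ^ K ∣ P) : P = 0 := by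
  induction K generalizing P with
  | zero => simpa using hP
  | succ K ih =>
    by_contra hne
    obtain ⟨a, ha⟩ := Finset.nonempty_iff_ne_empty.mpr (mt support_eq_empty.mp hne)
    -- The Euler operator `z d/dz - a` multiplies the coefficient of `z ^ n` by `n - a`: it deletes
    -- the monomial of exponent `a`, creates none, and lowers the order of the zero at `1` by at
    -- most one.
    set Q : ℂ[X] := X * derivative P - C (a : ℂ) * P with hQ
    have hcoeff : ∀ n, Q.coeff n = ((n : ℂ) - a) * P.coeff n := by
      intro n
      cases n with
      | zero => simp [hQ]
      | succ n => simp [hQ, coeff_X_mul, coeff_derivative]; ring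
    have hsub : Q.support ⊆ P.support.erase a := by
      intro n hn
      rw [mem_support_iff, hcoeff] at hn
      refine Finset.mem_erase.mpr ⟨?_, mem_support_iff.mpr (right_ne_zero_of_mul hn)⟩
      rintro rfl
      simp at hn
    have hQ0 : Q = 0 := by
      refine ih Q ?_ ?_
      · have := Finset.card_le_card hsub
        rw [Finset.card_erase_of_mem ha] at this
        omega
      · refine dvd_sub ?_ ?_
        · exact (pow_sub_one_dvd_derivative_of_pow_dvd hdvd).mul_left _
        · exact ((pow_dvd_pow _ (Nat.le_succ K)).trans hdvd).mul_left _
    have hmono : P = monomial a (P.coeff a) := by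
      ext n
      rw [coeff_monomial]
      split_ifs with h
      · rw [h]
      · have := hcoeff n
        rw [hQ0, coeff_zero, eq_comm, mul_eq_zero, sub_eq_zero] at this
        exact this.resolve_left fun h' => h (Nat.cast_injective h').symm
    have hroot : P.eval 1 = 0 := by
      have h1 : (X - C 1 : ℂ[X]) ∣ P := (dvd_pow_self _ K.succ_ne_zero).trans hdvd
      exact dvd_iff_isRoot.mp h1
    rw [hmono] at hroot
    simp at hroot
    exact mem_support_iff.mp ha hroot

open PowerSeries in
/-- If `X` is a polynomial of degree less than `l` and `X (1 - z) ^ K` has `l` consecutive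
vanishing coefficients starting at a position `c ≤ K`, then `X = 0`. -/
theorem eq_zero_of_gap {c K l : ℕ} (hc : c ≤ K) (S : ℂ⟦X⟧) (hS : ∀ t, l ≤ t → coeff t S = 0)
    (h : ∀ m, c ≤ m → m < c + l → coeff m (S * (1 - X) ^ K) = 0) : S = 0 := by
  have htr : ((trunc l S : Polynomial ℂ) : ℂ⟦X⟧) = S := by
    ext t
    rw [Polynomial.coeff_coe, coeff_trunc]
    split_ifs with ht
    · rfl
    · exact (hS t (not_lt.mp ht)).symm
  set P : Polynomial ℂ := trunc l S * (1 - Polynomial.X) ^ K with hP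
  have hcoe : (P : ℂ⟦X⟧) = S * (1 - X) ^ K := by
    rw [hP, Polynomial.coe_mul, Polynomial.coe_pow, Polynomial.coe_sub, htr]
    simp
  have hcoeff : ∀ m, P.coeff m = coeff m (S * (1 - X) ^ K) := by
    intro m
    rw [← hcoe, Polynomial.coeff_coe]
  by_cases hl : l = 0
  · ext t
    simpa using hS t (by omega)
  have hdeg : P.natDegree < K + l := by
    have h1 : (trunc l S).natDegree < l := by
      obtain ⟨l, rfl⟩ := Nat.exists_eq_succ_of_ne_zero hl
      exact natDegree_trunc_lt S l
    have h2 : ((1 - Polynomial.X : Polynomial ℂ) ^ K).natDegree ≤ K * 1 := by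
      refine Polynomial.natDegree_pow_le_of_le K ?_
      refine (Polynomial.natDegree_sub_le _ _).trans ?_
      simp
    have h3 : P.natDegree ≤ _ := Polynomial.natDegree_mul_le
    omega
  -- The gap leaves `c` positions below it and `K - c` above it, so `K` in all; this is where `c ≤
  -- K` matters.
  have hsupp : P.support ⊆ Finset.range c ∪ Finset.Ico (c + l) (K + l) := by
    intro m hm
    have hm1 : m < K + l := (Polynomial.le_natDegree_of_mem_supp m hm).trans_lt hdeg
    rw [Polynomial.mem_support_iff, hcoeff] at hm
    simp only [Finset.mem_union, Finset.mem_range, Finset.mem_Ico]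
    by_contra hcon
    exact hm (h m (by omega) (by omega))
  have hP0 : P = 0 := by
    refine eq_zero_of_card_support_le K P ?_ ?_
    · refine (Finset.card_le_card hsupp).trans ((Finset.card_union_le _ _).trans ?_)
      simp only [Finset.card_range, Nat.card_Ico]
      omega
    · refine Dvd.dvd.mul_left ?_ _
      refine pow_dvd_pow_of_dvd ?_ K
      exact ⟨-1, by simp⟩
  have h1X : (1 - Polynomial.X : Polynomial ℂ) ^ K ≠ 0 := by
    refine pow_ne_zero _ fun h0 => ?_
    simpa using congrArg (Polynomial.eval 0) h0
  have := (mul_eq_zero.mp (hP ▸ hP0)).resolve_right h1X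
  rw [← htr, this, Polynomial.coe_zero]

/-! ### The shift operator on arrays of entries -/

/-- The action of `X ↦ A X - X B` on the array of entries of `X` between two Jordan chains whose
eigenvalues differ by `w`. -/
def shiftOp (w : ℂ) (F : ℕ → ℕ → ℂ) (c d : ℕ) : ℂ :=
  w * F c d + F (c + 1) d - if d = 0 then 0 else F c (d - 1)

theorem shiftOp_iterate_zero (w : ℂ) (k c d : ℕ) : (shiftOp w)^[k] (fun _ _ => 0) c d = 0 := by
  have : (shiftOp w)^[k] (fun _ _ => 0) = fun _ _ => 0 :=
    Function.iterate_fixed (by ext; simp [shiftOp]) k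
  rw [this]

theorem shiftOp_iterate_offDiagonal {F : ℕ → ℕ → ℂ} {r s : ℕ}
    (hF : ∀ c d, d + r ≠ c + s → F c d = 0) (K c d : ℕ) (h : d + r ≠ c + K + s) :
    (shiftOp 0)^[K] F c d = 0 := by
  induction K generalizing c d with
  | zero => exact hF c d h
  | succ K ih =>
    rw [Function.iterate_succ_apply', shiftOp, ih (c + 1) d (by omega)]
    split_ifs with hd
    · simp
    · rw [ih c (d - 1) (by omega)]
      simp

open PowerSeries in
/-- Along a diagonal, `shiftOp 0` is multiplication by `1 - z`. -/
theorem shiftOp_iterate_diagonal (F : ℕ → ℕ → ℂ) {r s : ℕ} (hrs : r = 0 ∨ s = 0) (K c m : ℕ)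
    (h : c + K = r + m) :
    (shiftOp 0)^[K] F c (s + m) = coeff m (PowerSeries.mk (fun t => F (r + t) (s + t)) * (1 - X) ^ K) := by
  induction K generalizing c m with
  | zero =>
    obtain rfl : c = r + m := h
    simp
  | succ K ih =>
    rw [Function.iterate_succ_apply', shiftOp, ih (c + 1) m (by omega), pow_succ, ← mul_assoc,
      mul_sub, mul_one, map_sub]
    -- Position `m = 0` forces `r > 0`, hence `s = 0`: the diagonal begins in the first column,
    -- where the term from the left is absent, just as multiplication by `z` contributes nothing to
    -- the constant coefficient.
    cases m with
    | zero =>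
      have : s = 0 := by omega
      subst this
      simp
    | succ m =>
      rw [if_neg (by omega), coeff_succ_mul_X, show s + (m + 1) - 1 = s + m by omega,
        ih c m (by omega)]
      simp

/-- One step back: an array which is killed by `shiftOp w`, `w ≠ 0`, on the first `f` columns and
which has finitely many rows vanishes there. -/
theorem eq_zero_of_shiftOp_eq_zero {w : ℂ} (hw : w ≠ 0) {F : ℕ → ℕ → ℂ} {e f : ℕ}
    (hF : ∀ c d, e ≤ c → d < f → F c d = 0) (h : ∀ c d, d < f → shiftOp w F c d = 0) :
    ∀ c d, d < f → F c d = 0 := by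
  intro c d
  -- Columns are treated from left to right and each column from the bottom row upwards, so both
  -- neighbours in `shiftOp` already vanish and only `w * F c d` is left.
  induction d using Nat.strong_induction_on generalizing c with
  | _ d ihd =>
    intro hd
    by_cases hc : e ≤ c
    · exact hF c d hc hd
    induction c using Nat.strong_decreasing_induction with
    | base => exact ⟨e, fun m hm h => absurd hm.le h⟩
    | step c ihc =>
      have h1 : F (c + 1) d = 0 := by
        by_cases hc' : e ≤ c + 1
        · exact hF _ _ hc' hd
        · exact ihc (c + 1) (Nat.lt_succ_self c) hc'
      have h2 := h c d hd
      rw [shiftOp, h1] at h2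
      have h3 : (if d = 0 then 0 else F c (d - 1)) = 0 := by
        split_ifs with h0
        · rfl
        · exact ihd (d - 1) (by omega) c (by omega)
      rw [h3] at h2
      simpa [hw] using h2

open Matrix

/-- If `E` and `E'` pick the entries along Jordan chains of `A` and `B`, the operator `phi A B`
acts on these entries as `shiftOp`. -/
theorem dotProduct_phi_pow {ι κ : Type*} [Fintype ι] [Fintype κ] {A : Matrix ι ι ℂ}
    {B : Matrix κ κ ℂ} {E : ℕ → ι → ℂ} {E' : ℕ → κ → ℂ} {z z' : ℂ} {f : ℕ}
    (hA : ∀ c, E c ᵥ* A = z • E c + E (c + 1))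
    (hB : ∀ d, d < f → B *ᵥ E' d = z' • E' d + if d = 0 then 0 else E' (d - 1))
    (k : ℕ) (X : Matrix ι κ ℂ) (c d : ℕ) (hd : d < f) :
    E c ⬝ᵥ ((phi A B ^ k) X *ᵥ E' d) =
      (shiftOp (z - z'))^[k] (fun c d => E c ⬝ᵥ (X *ᵥ E' d)) c d := by
  induction k generalizing c d with
  | zero => simp
  | succ k ih =>
    rw [Function.iterate_succ_apply', shiftOp, ← ih c d hd, ← ih (c + 1) d hd, pow_succ']
    set Y := (phi A B ^ k) X with hY
    have h1 : E c ⬝ᵥ ((A * Y) *ᵥ E' d) = z * (E c ⬝ᵥ (Y *ᵥ E' d)) + E (c + 1) ⬝ᵥ (Y *ᵥ E' d) := by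
      rw [← mulVec_mulVec, dotProduct_mulVec, hA, add_dotProduct, smul_dotProduct, smul_eq_mul]
    have h2 : E c ⬝ᵥ ((Y * B) *ᵥ E' d) = z' * (E c ⬝ᵥ (Y *ᵥ E' d)) +
        if d = 0 then 0 else E c ⬝ᵥ (Y *ᵥ E' (d - 1)) := by
      rw [← mulVec_mulVec, hB d hd, mulVec_add, mulVec_smul, dotProduct_add, dotProduct_smul,
        smul_eq_mul]
      split_ifs <;> simp
    have h3 : (phi A B * phi A B ^ k) X = A * Y - Y * B := rfl
    rw [h3, sub_mulVec, dotProduct_sub, h1, h2]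
    split_ifs with h0
    · ring
    · rw [← ih c (d - 1) (by omega)]
      ring

/-! ### The coefficient system `(*)` as a window of power series coefficients -/

theorem jordanNilpotent_apply (p : ℕ) (x y : Fin p) :
    jordanNilpotent p x y = if (y : ℕ) = x + 1 then 1 else 0 := by
  rw [jordanNilpotent, Matrix.sum_apply]
  simp only [matUnit, Matrix.of_apply]
  have hy := y.2
  split_ifs with h
  · rw [Finset.sum_eq_single ((x : ℕ) + 1)]
    · simp [h]
    · intro b _ hb
      rw [if_neg (by omega)]
    · intro hx
      exact absurd (Finset.mem_Icc.mpr ⟨by omega, by omega⟩) hx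
  · refine Finset.sum_eq_zero fun b _ => ?_
    rw [if_neg (by omega)]

/-- The `c`-th standard vector of `Fin p → ℂ`, zero out of range. -/
def stdVec (p c : ℕ) : Fin p → ℂ := fun x => if (x : ℕ) = c then 1 else 0

theorem stdVec_eq {p c : ℕ} (h : c < p) : stdVec p c = Pi.single (⟨c, h⟩ : Fin p) 1 := by
  ext x
  simp [stdVec, Pi.single_apply, Fin.ext_iff]

theorem stdVec_eq_zero {p c : ℕ} (h : p ≤ c) : stdVec p c = 0 := by
  ext x
  have := x.2
  simp only [stdVec, Pi.zero_apply]
  rw [if_neg (by omega)]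

theorem stdVec_vecMul_jordanNilpotent (p c : ℕ) :
    stdVec p c ᵥ* jordanNilpotent p = (0 : ℂ) • stdVec p c + stdVec p (c + 1) := by
  rw [zero_smul, zero_add]
  by_cases h : c < p
  · rw [stdVec_eq h, single_one_vecMul]
    ext y
    simp [Matrix.row, jordanNilpotent_apply, stdVec]
  · rw [stdVec_eq_zero (not_lt.mp h), stdVec_eq_zero (by omega), zero_vecMul]

theorem jordanNilpotent_mulVec_stdVec (p d : ℕ) (h : d < p) :
    jordanNilpotent p *ᵥ stdVec p d =
      (0 : ℂ) • stdVec p d + if d = 0 then 0 else stdVec p (d - 1) := by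
  rw [zero_smul, zero_add, stdVec_eq h, mulVec_single_one]
  ext x
  simp only [Matrix.col_apply, jordanNilpotent_apply]
  split_ifs with h1 h2 h2
  · omega
  · simp only [stdVec]; rw [if_pos (by omega)]
  · rfl
  · simp only [stdVec]; rw [if_neg (by omega)]

theorem stdVec_dotProduct {p Q c d : ℕ} (hc : c < p) (hd : d < Q) (X : Matrix (Fin p) (Fin Q) ℂ) :
    stdVec p c ⬝ᵥ (X *ᵥ stdVec Q d) = X ⟨c, hc⟩ ⟨d, hd⟩ := by
  rw [stdVec_eq hc, stdVec_eq hd, mulVec_single_one, single_one_dotProduct, Matrix.col_apply]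

/-- The power series with coefficients `x 0, …, x l`. -/
def coeffSeries {l : ℕ} (x : Fin (l + 1) → ℂ) : PowerSeries ℂ :=
  PowerSeries.mk fun t => if h : t < l + 1 then x ⟨t, h⟩ else 0

/-- The coefficient form of `SolvesCoeff`. -/
def SolvesWindow (K c l : ℕ) (x : Fin (l + 1) → ℂ) : Prop :=
  ∀ t, t ≤ l → PowerSeries.coeff (c + t) (coeffSeries x * (1 - PowerSeries.X) ^ K) = 1

theorem sum_ite_diagonal {l : ℕ} (x : Fin (l + 1) → ℂ) {r s c d t : ℕ} (hc : c = r + t)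
    (hd : d = s + t) :
    ∑ t' : Fin (l + 1), x t' * (if c = r + t' ∧ d = s + t' then 1 else 0) =
      if h : t < l + 1 then x ⟨t, h⟩ else 0 := by
  split_ifs with h
  · rw [Finset.sum_eq_single ⟨t, h⟩]
    · rw [if_pos ⟨hc, hd⟩, mul_one]
    · intro b _ hb
      rw [if_neg, mul_zero]
      rintro ⟨h1, -⟩
      exact hb (Fin.ext (show (b : ℕ) = t by omega))
    · simp
  · refine Finset.sum_eq_zero fun b _ => ?_
    have := b.2
    rw [if_neg (by omega), mul_zero]

theorem sum_ite_offDiagonal {l : ℕ} (x : Fin (l + 1) → ℂ) {r s c d : ℕ} (h : d + r ≠ c + s) :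
    ∑ t' : Fin (l + 1), x t' * (if c = r + t' ∧ d = s + t' then 1 else 0) = 0 := by
  refine Finset.sum_eq_zero fun b _ => ?_
  rw [if_neg (by omega), mul_zero]

theorem phi_jordan_pow_apply {p Q K r s l : ℕ} (hr : 1 ≤ r) (hs : 1 ≤ s) (hrl : r + l ≤ p)
    (hsl : s + l ≤ Q) (x : Fin (l + 1) → ℂ) (c : Fin p) (d : Fin Q) :
    (phi (jordanNilpotent p) (jordanNilpotent Q) ^ K)
      (∑ t : Fin (l + 1), x t • matUnit p Q (r + t) (s + t)) c d =
    (shiftOp 0)^[K] (fun c d => ∑ t' : Fin (l + 1), x t' *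
      (if c = r - 1 + t' ∧ d = s - 1 + t' then 1 else 0)) c d := by
  refine (stdVec_dotProduct c.2 d.2 _).symm.trans ?_
  rw [dotProduct_phi_pow (stdVec_vecMul_jordanNilpotent p) (jordanNilpotent_mulVec_stdVec Q) K _ _ _
    d.2, sub_zero]
  refine congrFun (congrFun (congrArg ((shiftOp 0)^[K]) ?_) (c : ℕ)) (d : ℕ)
  funext c d
  by_cases h : c < p ∧ d < Q
  · rw [stdVec_dotProduct h.1 h.2, Matrix.sum_apply]
    refine Finset.sum_congr rfl fun t _ => ?_
    simp only [Matrix.smul_apply, matUnit, Matrix.of_apply, smul_eq_mul]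
    congr 2
    exact propext (by omega)
  · have h0 : stdVec p c = 0 ∨ stdVec Q d = 0 := by
      rcases not_and_or.mp h with h | h
      · exact Or.inl (stdVec_eq_zero (not_lt.mp h))
      · exact Or.inr (stdVec_eq_zero (not_lt.mp h))
    trans 0
    · rcases h0 with h0 | h0 <;> simp [h0]
    · symm
      refine Finset.sum_eq_zero fun t _ => ?_
      have := t.2
      rw [if_neg (by omega), mul_zero]

/-- Both sides of the matrix equation live on one diagonal, where the `K`-th power is multiplication
by `(1 - z) ^ K`. Row `t` of the target shows the coefficient at `K + 1 - r + t`: the rows `t ≤ l`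
demand the value `1`, and the free `y` absorbs the others. The resulting condition involves neither
`p`, `Q` nor `s`. -/
theorem solvesCoeff_iff {p Q K r s l : ℕ} (hr : 1 ≤ r) (hs : 1 ≤ s) (hrs : r = 1 ∨ s = 1)
    (hrK : r ≤ K + 1) (hrl : r + l ≤ p) (hsl : s + l ≤ Q) (hQ : K + 1 + l + s ≤ Q + r)
    (x : Fin (l + 1) → ℂ) :
    SolvesCoeff p Q K r s l x ↔ SolvesWindow K (K + 1 - r) l x := by
  set F : ℕ → ℕ → ℂ := fun c d => ∑ t' : Fin (l + 1), x t' *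
      (if c = r - 1 + t' ∧ d = s - 1 + t' then 1 else 0) with hF
  have hdiag : ∀ c m, c + K = r - 1 + m → (shiftOp 0)^[K] F c (s - 1 + m) =
      PowerSeries.coeff m (coeffSeries x * (1 - PowerSeries.X) ^ K) := by
    intro c m h
    rw [shiftOp_iterate_diagonal F (by omega) K c m h]
    congr 2
    ext t
    rw [coeffSeries, PowerSeries.coeff_mk, PowerSeries.coeff_mk]
    exact sum_ite_diagonal x rfl rfl
  have hoff : ∀ c d, d + (r - 1) ≠ c + K + (s - 1) → (shiftOp 0)^[K] F c d = 0 := by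
    intro c d h
    exact shiftOp_iterate_offDiagonal (fun c d h => sum_ite_offDiagonal x h) K c d h
  have hrhs : ∀ (y : ℕ → ℂ) (c : Fin p) (d : Fin Q),
      (∑ t : Fin (l + 1), matUnit p Q (1 + t) (K + 1 - r + s + t) +
        ∑ t ∈ Finset.Ioo l p, y t • matUnit p Q (1 + t) (K + 1 - r + s + t)) c d =
      if (d : ℕ) + 1 = K + 1 - r + s + c then (if (c : ℕ) ≤ l then 1 else y c) else 0 := by
    intro y c d
    have hc := c.2
    rw [Matrix.add_apply, Matrix.sum_apply, Matrix.sum_apply]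
    simp only [Matrix.smul_apply, matUnit, Matrix.of_apply, smul_eq_mul]
    split_ifs with h1 h2
    · rw [Finset.sum_eq_single (⟨c, by omega⟩ : Fin (l + 1)), Finset.sum_eq_zero]
      · rw [if_pos (by simp only; omega), add_zero]
      · intro t ht
        rw [Finset.mem_Ioo] at ht
        rw [if_neg (by omega), mul_zero]
      · intro t _ ht
        rw [if_neg]
        rintro ⟨h3, -⟩
        exact ht (Fin.ext (show (t : ℕ) = c by omega))
      · simp
    · rw [Finset.sum_eq_zero, Finset.sum_eq_single (c : ℕ)]
      · rw [if_pos (by omega), zero_add, mul_one]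
      · intro t _ ht
        rw [if_neg (by omega), mul_zero]
      · intro h
        exact absurd (Finset.mem_Ioo.mpr ⟨by omega, hc⟩) h
      · intro t _
        have := t.2
        rw [if_neg (by omega)]
    · rw [Finset.sum_eq_zero, Finset.sum_eq_zero, add_zero]
      · intro t _
        rw [if_neg (by omega), mul_zero]
      · intro t _
        rw [if_neg (by omega)]
  constructor
  · rintro ⟨y, hy⟩ t ht
    have hcp : t < p := by omega
    -- The bound on `Q` says exactly that the last column of the window, reached at `t = l`, is
    -- still inside the matrix.
    have hdQ : s - 1 + (K + 1 - r + t) < Q := by omega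
    have := congrFun (congrFun hy ⟨t, hcp⟩) ⟨s - 1 + (K + 1 - r + t), hdQ⟩
    rw [phi_jordan_pow_apply hr hs hrl hsl, hrhs, hdiag _ _ (by simp only; omega)] at this
    rw [this, if_pos (by simp only; omega), if_pos ht]
  · intro h
    refine ⟨fun t => PowerSeries.coeff (K + 1 - r + t)
      (coeffSeries x * (1 - PowerSeries.X) ^ K), ?_⟩
    ext c d
    rw [phi_jordan_pow_apply hr hs hrl hsl, hrhs]
    split_ifs with h1 h2
    · rw [show (d : ℕ) = s - 1 + (K + 1 - r + c) by omega, hdiag _ _ (by omega)]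
      exact h c h2
    · rw [show (d : ℕ) = s - 1 + (K + 1 - r + c) by omega, hdiag _ _ (by omega)]
    · exact hoff _ _ (by omega)

theorem coeffSeries_eq_zero_iff {l : ℕ} {x : Fin (l + 1) → ℂ} : coeffSeries x = 0 ↔ x = 0 := by
  constructor
  · intro h
    ext t
    have := congrArg (PowerSeries.coeff (t : ℕ)) h
    simpa [coeffSeries, PowerSeries.coeff_mk, t.is_le] using this
  · rintro rfl
    ext t
    simp [coeffSeries]

/-- The system is square, so it suffices that the homogeneous one has only the zero solution, and
that is `eq_zero_of_gap` with a gap of length `l + 1`. -/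
theorem existsUnique_solvesWindow {K c : ℕ} (hc : c ≤ K) (l : ℕ) :
    ∃! x : Fin (l + 1) → ℂ, SolvesWindow K c l x := by
  let T : (Fin (l + 1) → ℂ) →ₗ[ℂ] (Fin (l + 1) → ℂ) :=
    { toFun := fun x t => PowerSeries.coeff (c + t) (coeffSeries x * (1 - PowerSeries.X) ^ K)
      map_add' := by
        intro x y
        have : coeffSeries (x + y) = coeffSeries x + coeffSeries y := by
          ext t
          simp only [coeffSeries, PowerSeries.coeff_mk, map_add]
          split_ifs <;> simp
        ext t
        simp [this, add_mul]
      map_smul' := by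
        intro a x
        have : coeffSeries (a • x) = a • coeffSeries x := by
          ext t
          simp [coeffSeries, PowerSeries.coeff_mk]
        ext t
        simp [this] }
  have hinj : Function.Injective T := by
    rw [injective_iff_map_eq_zero]
    intro x hx
    refine coeffSeries_eq_zero_iff.mp (eq_zero_of_gap hc _ (l := l + 1) ?_ ?_)
    · intro t ht
      rw [coeffSeries, PowerSeries.coeff_mk, dif_neg (by omega)]
    · intro m h1 h2
      have := congrFun hx ⟨m - c, by omega⟩
      simpa [T, Nat.add_sub_cancel' h1] using this
  have hbij : Function.Bijective T := ⟨hinj, LinearMap.surjective_of_injective hinj⟩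
  obtain ⟨x, hx, hu⟩ := hbij.existsUnique (fun _ => 1)
  refine ⟨x, fun t ht => congrFun hx ⟨t, by omega⟩, fun y hy => hu y ?_⟩
  ext t
  exact hy t (by omega)

/-- One more factor `1 - z` replaces the `l + 1` consecutive ones by their `l` differences, which
are zero. If the last coefficient vanished, the degree would be below `l` and the gap lemma would
give `x = 0`. -/
theorem SolvesWindow.last_ne_zero {K c l : ℕ} (hc : c ≤ K) {x : Fin (l + 1) → ℂ}
    (h : SolvesWindow K c l x) : x (Fin.last l) ≠ 0 := by
  intro h0
  have hS : coeffSeries x = 0 := by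
    refine eq_zero_of_gap (c := c + 1) (K := K + 1) (l := l) (by omega) _ ?_ ?_
    · intro t ht
      rw [coeffSeries, PowerSeries.coeff_mk]
      split_ifs with h1
      · obtain rfl : t = l := by omega
        exact h0
      · rfl
    · intro m h1 h2
      obtain ⟨t, rfl⟩ : ∃ t, m = c + t + 1 := ⟨m - c - 1, by omega⟩
      rw [pow_succ, ← mul_assoc, mul_sub, mul_one, map_sub, PowerSeries.coeff_succ_mul_X,
        h t (by omega), add_assoc, h (t + 1) (by omega), sub_self]
  have := h 0 (Nat.zero_le l)
  rw [hS] at this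
  simp at this


/-! ### Weyr sequences and the chains of a Weyr matrix -/

/-- The sequence `γ 1 ≥ γ 2 ≥ ⋯` vanishes beyond position `p`. -/
structure IsWeyrSeq (p : ℕ) (γ : ℕ → ℕ) : Prop where
  one_le : 1 ≤ p
  antitone : ∀ c, 1 ≤ c → γ (c + 1) ≤ γ c
  eq_zero : ∀ c, p < c → γ c = 0

namespace IsWeyrSeq

variable {p : ℕ} {γ : ℕ → ℕ}

theorem le (h : IsWeyrSeq p γ) {c d : ℕ} (hc : 1 ≤ c) (hcd : c ≤ d) : γ d ≤ γ c := by
  induction d, hcd using Nat.le_induction with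
  | base => exact le_rfl
  | succ d hd ih => exact (h.antitone d (hc.trans hd)).trans ih

theorem le_of_lt (h : IsWeyrSeq p γ) {u c : ℕ} (hu : u < γ c) : c ≤ p := by
  by_contra hc
  rw [h.eq_zero c (not_le.mp hc)] at hu
  exact Nat.not_lt_zero _ hu

/-- The length of the `u`-th Jordan chain. -/
theorem exists_length (h : IsWeyrSeq p γ) (u : ℕ) : ∃ e, ∀ c, u < γ (c + 1) ↔ c < e := by
  classical
  have hex : ∃ c, ¬ u < γ (c + 1) := ⟨p, fun hu => by have := h.le_of_lt hu; omega⟩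
  refine ⟨Nat.find hex, fun c => ⟨fun hu => ?_, fun hc => not_not.mp (Nat.find_min hex hc)⟩⟩
  by_contra hc
  exact Nat.find_spec hex (hu.trans_le (h.le (by omega) (by omega)))

end IsWeyrSeq

section chainVec

variable {a : ℕ} (p : Fin a → ℕ) (α : Fin a → ℕ → ℕ)

/-- The standard vector at position `(i, c, u)`, zero out of range. -/
def chainVec (i : Fin a) (u c : ℕ) : (Σ i : Fin a, BlockIdx (p i) (α i)) → ℂ :=
  fun x => if x.1 = i ∧ (x.2.1 : ℕ) = c ∧ (x.2.2 : ℕ) = u then 1 else 0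

variable {p α}

theorem sigma_ext_iff {x y : Σ i : Fin a, BlockIdx (p i) (α i)} :
    x = y ↔ x.1 = y.1 ∧ (x.2.1 : ℕ) = y.2.1 ∧ (x.2.2 : ℕ) = y.2.2 := by
  constructor
  · rintro rfl
    exact ⟨rfl, rfl, rfl⟩
  · obtain ⟨i, ⟨c, hc⟩, ⟨u, hu⟩⟩ := x
    obtain ⟨i', ⟨c', hc'⟩, ⟨u', hu'⟩⟩ := y
    rintro ⟨h1, h2, h3⟩
    simp only at h1 h2 h3
    subst h1 h2 h3
    rfl

theorem chainVec_eq {i : Fin a} {u c : ℕ} (hc : c < p i) (hu : u < α i (c + 1)) :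
    chainVec p α i u c = Pi.single ⟨i, ⟨c, hc⟩, ⟨u, hu⟩⟩ 1 := by
  ext x
  simp only [Pi.single_apply, sigma_ext_iff, chainVec]

theorem chainVec_eq_zero {i : Fin a} {u c : ℕ} (hu : ¬ u < α i (c + 1)) :
    chainVec p α i u c = 0 := by
  ext ⟨i', ⟨c', hc'⟩, ⟨u', hu'⟩⟩
  simp only [chainVec, Pi.zero_apply]
  rw [if_neg]
  rintro ⟨h1, h2, h3⟩
  subst h1 h2 h3
  exact hu hu'

theorem weyrMatrix_apply (lam : Fin a → ℂ) (x y : Σ i : Fin a, BlockIdx (p i) (α i)) :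
    weyrMatrix lam p α x y =
      (if x = y then lam x.1 else 0) +
        if x.1 = y.1 ∧ (y.2.1 : ℕ) = x.2.1 + 1 ∧ (x.2.2 : ℕ) = y.2.2 then 1 else 0 := by
  rw [weyrMatrix, blockDiagonal'_apply]
  obtain ⟨i, x⟩ := x
  obtain ⟨i', y⟩ := y
  by_cases h : i = i'
  · subst h
    simp [weyrNilpotent, Matrix.one_apply]
  · have : (⟨i, x⟩ : Σ i : Fin a, BlockIdx (p i) (α i)) ≠ ⟨i', y⟩ := by
      intro h'
      exact h (congrArg Sigma.fst h')
    simp [h]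

theorem chainVec_vecMul {i : Fin a} (h : IsWeyrSeq (p i) (α i)) (lam : Fin a → ℂ) (u c : ℕ) :
    chainVec p α i u c ᵥ* weyrMatrix lam p α =
      lam i • chainVec p α i u c + chainVec p α i u (c + 1) := by
  by_cases hu : u < α i (c + 1)
  · have hc : c < p i := h.le_of_lt hu
    rw [chainVec_eq hc hu, single_one_vecMul]
    ext y
    rw [Matrix.row_apply, weyrMatrix_apply, Pi.add_apply, Pi.smul_apply, Pi.single_apply, chainVec]
    congr 1
    · simp only [eq_comm, smul_eq_mul, mul_ite, mul_one, mul_zero]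
    · simp only [eq_comm]
  · have hu' : ¬ u < α i (c + 1 + 1) := fun h' => hu (h'.trans_le (h.antitone _ (by omega)))
    rw [chainVec_eq_zero hu, chainVec_eq_zero hu', zero_vecMul, smul_zero, zero_add]

theorem weyrMatrix_mulVec {j : Fin a} (h : IsWeyrSeq (p j) (α j)) (mu : Fin a → ℂ) (v d : ℕ)
    (hv : v < α j (d + 1)) :
    weyrMatrix mu p α *ᵥ chainVec p α j v d =
      mu j • chainVec p α j v d + if d = 0 then 0 else chainVec p α j v (d - 1) := by
  have hd : d < p j := h.le_of_lt hv
  rw [chainVec_eq hd hv, mulVec_single_one]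
  ext x
  rw [Matrix.col_apply, weyrMatrix_apply, Pi.add_apply, Pi.smul_apply, Pi.single_apply]
  congr 1
  · by_cases hx : x = ⟨j, ⟨d, hd⟩, ⟨v, hv⟩⟩
    · rw [if_pos hx, if_pos hx, hx, smul_eq_mul, mul_one]
    · rw [if_neg hx, if_neg hx, smul_zero]
  · split_ifs with h1 h2 h2
    · simp only at h1
      omega
    · obtain ⟨h3, h4, h5⟩ := h1
      dsimp only at h3 h4 h5
      simp only [chainVec]
      rw [if_pos ⟨h3, by omega, h5⟩]
    · rfl
    · simp only [chainVec]
      rw [if_neg]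
      rintro ⟨h3, h4, h5⟩
      exact h1 ⟨h3, by simp only; omega, h5⟩

end chainVec

/-! ### The candidates lie in the kernel and are independent, and leading entries detect kernel
elements -/

section basis

variable {a b : ℕ} {p : Fin a → ℕ} {α : Fin a → ℕ → ℕ} {q : Fin b → ℕ} {β : Fin b → ℕ → ℕ}

/-- The entry of a matrix in row `(i, c, u)` and column `(j, d, v)`, zero out of range. -/
def entry (X : Matrix (Σ i : Fin a, BlockIdx (p i) (α i)) (Σ j : Fin b, BlockIdx (q j) (β j)) ℂ)
    (i : Fin a) (j : Fin b) (u v c d : ℕ) : ℂ :=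
  chainVec p α i u c ⬝ᵥ (X *ᵥ chainVec q β j v d)

theorem entry_eq
    (X : Matrix (Σ i : Fin a, BlockIdx (p i) (α i)) (Σ j : Fin b, BlockIdx (q j) (β j)) ℂ)
    {i : Fin a} {j : Fin b} {u v c d : ℕ} (hc : c < p i) (hu : u < α i (c + 1))
    (hd : d < q j) (hv : v < β j (d + 1)) :
    entry X i j u v c d = X ⟨i, ⟨c, hc⟩, ⟨u, hu⟩⟩ ⟨j, ⟨d, hd⟩, ⟨v, hv⟩⟩ := by
  rw [entry, chainVec_eq hc hu, chainVec_eq hd hv, mulVec_single_one, single_one_dotProduct,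
    Matrix.col_apply]

theorem entry_eq_zero
    (X : Matrix (Σ i : Fin a, BlockIdx (p i) (α i)) (Σ j : Fin b, BlockIdx (q j) (β j)) ℂ)
    {i : Fin a} {j : Fin b} {u v c d : ℕ} (h : ¬ (u < α i (c + 1) ∧ v < β j (d + 1))) :
    entry X i j u v c d = 0 := by
  rw [entry]
  rcases not_and_or.mp h with h | h <;> simp [chainVec_eq_zero h]

theorem eq_zero_of_entry
    {X : Matrix (Σ i : Fin a, BlockIdx (p i) (α i)) (Σ j : Fin b, BlockIdx (q j) (β j)) ℂ}
    (h : ∀ i j u v c d, u < α i (c + 1) → v < β j (d + 1) → entry X i j u v c d = 0) : X = 0 := by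
  ext ⟨i, ⟨c, hc⟩, ⟨u, hu⟩⟩ ⟨j, ⟨d, hd⟩, ⟨v, hv⟩⟩
  rw [← entry_eq X hc hu hd hv]
  exact h i j u v c d hu hv

theorem entry_phi_pow (hα : ∀ i, IsWeyrSeq (p i) (α i)) (hβ : ∀ j, IsWeyrSeq (q j) (β j))
    (lam : Fin a → ℂ) (mu : Fin b → ℂ) (k : ℕ)
    (X : Matrix (Σ i : Fin a, BlockIdx (p i) (α i)) (Σ j : Fin b, BlockIdx (q j) (β j)) ℂ)
    (i : Fin a) (j : Fin b) (u v c d : ℕ) (hv : v < β j (d + 1)) :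
    entry ((phi (weyrMatrix lam p α) (weyrMatrix mu q β) ^ k) X) i j u v c d =
      (shiftOp (lam i - mu j))^[k] (entry X i j u v) c d := by
  obtain ⟨f, hf⟩ := (hβ j).exists_length v
  exact dotProduct_phi_pow (f := f) (chainVec_vecMul (hα i) lam u)
    (fun d hd => weyrMatrix_mulVec (hβ j) mu v d ((hf d).mpr hd)) k X c d ((hf d).mp hv)

/-- A block `(i, j)` with `lam i ≠ mu j` does not contribute to the kernels. -/
theorem entry_eq_zero_of_ne (hα : ∀ i, IsWeyrSeq (p i) (α i)) (hβ : ∀ j, IsWeyrSeq (q j) (β j))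
    {lam : Fin a → ℂ} {mu : Fin b → ℂ} {i : Fin a} {j : Fin b} (hne : lam i ≠ mu j) (u v k : ℕ)
    (X : Matrix (Σ i : Fin a, BlockIdx (p i) (α i)) (Σ j : Fin b, BlockIdx (q j) (β j)) ℂ)
    (h : ∀ c d, v < β j (d + 1) →
      entry ((phi (weyrMatrix lam p α) (weyrMatrix mu q β) ^ k) X) i j u v c d = 0) :
    ∀ c d, v < β j (d + 1) → entry X i j u v c d = 0 := by
  induction k generalizing X with
  | zero => exact h
  | succ k ih =>
    have h1 := ih (phi (weyrMatrix lam p α) (weyrMatrix mu q β) X) (by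
      intro c d hv
      have := h c d hv
      rwa [pow_succ] at this)
    obtain ⟨e, he⟩ := (hα i).exists_length u
    obtain ⟨f, hf⟩ := (hβ j).exists_length v
    intro c d hv
    refine eq_zero_of_shiftOp_eq_zero (sub_ne_zero.mpr hne) (F := entry X i j u v) (e := e) (f := f)
      (fun c d hc _ => entry_eq_zero X fun h => ?_) (fun c d hd => ?_) c d ((hf d).mp hv)
    · exact absurd ((he c).mp h.1) (not_lt.mpr hc)
    · have := h1 c d ((hf d).mpr hd)
      rwa [← pow_one (phi (weyrMatrix lam p α) (weyrMatrix mu q β)),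
        entry_phi_pow hα hβ lam mu 1 X i j u v c d ((hf d).mpr hd)] at this

theorem kernelElement_apply (x : Fin a → Fin b → ℕ → ℕ → (l : ℕ) → Fin (l + 1) → ℂ)
    (L : Label a b) (hr : 1 ≤ L.r) (hs : 1 ≤ L.s)
    (hu1 : 1 ≤ L.u) (hu : L.u ≤ α L.i (L.r + L.l)) (hv1 : 1 ≤ L.v) (hv : L.v ≤ β L.j (L.s + L.l))
    (X : Σ i : Fin a, BlockIdx (p i) (α i)) (Y : Σ j : Fin b, BlockIdx (q j) (β j)) :
    kernelElement p q α β x L X Y =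
      if L.i = X.1 ∧ L.j = Y.1 ∧ L.u = X.2.2 + 1 ∧ L.v = Y.2.2 + 1 then
        ∑ t : Fin (L.l + 1), x L.i L.j L.r L.s L.l t *
          (if (X.2.1 : ℕ) = L.r - 1 + t ∧ (Y.2.1 : ℕ) = L.s - 1 + t then 1 else 0) else 0 := by
  obtain ⟨i, j, r, s, l, u, v⟩ := L
  obtain ⟨i', ⟨c, hc⟩, ⟨u', hu'⟩⟩ := X
  obtain ⟨j', ⟨d, hd⟩, ⟨v', hv'⟩⟩ := Y
  simp only at hr hs hu1 hu hv1 hv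
  simp only [kernelElement, outerBox, Matrix.of_apply]
  by_cases hi : i' = i
  · subst hi
    by_cases hj : j' = j
    · subst hj
      rw [dif_pos rfl, dif_pos rfl, Matrix.sum_apply]
      simp only [true_and]
      split_ifs with huv
      · refine Finset.sum_congr rfl fun t _ => ?_
        simp only [Matrix.smul_apply, blockBox, Matrix.of_apply, matUnit, smul_eq_mul]
        congr 1
        rw [dif_pos ⟨by omega, by omega⟩]
        split_ifs <;> first | rfl | omega
      · refine Finset.sum_eq_zero fun t _ => ?_
        simp only [Matrix.smul_apply, blockBox, Matrix.of_apply, matUnit, smul_eq_mul]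
        split_ifs <;> first | omega | simp
    · rw [dif_pos rfl, dif_neg hj, if_neg]
      exact fun h => hj h.2.1.symm
  · rw [dif_neg hi, if_neg]
    exact fun h => hi h.1.symm

theorem entry_kernelElement (hα : ∀ i, IsWeyrSeq (p i) (α i)) (hβ : ∀ j, IsWeyrSeq (q j) (β j))
    (x : Fin a → Fin b → ℕ → ℕ → (l : ℕ) → Fin (l + 1) → ℂ)
    (L : Label a b) (hr : 1 ≤ L.r) (hs : 1 ≤ L.s)
    (hu1 : 1 ≤ L.u) (hu : L.u ≤ α L.i (L.r + L.l)) (hv1 : 1 ≤ L.v) (hv : L.v ≤ β L.j (L.s + L.l))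
    (i : Fin a) (j : Fin b) (u v c d : ℕ) :
    entry (kernelElement p q α β x L) i j u v c d =
      if L.i = i ∧ L.j = j ∧ L.u = u + 1 ∧ L.v = v + 1 then
        ∑ t : Fin (L.l + 1), x L.i L.j L.r L.s L.l t *
          (if c = L.r - 1 + t ∧ d = L.s - 1 + t then 1 else 0) else 0 := by
  by_cases h : u < α i (c + 1) ∧ v < β j (d + 1)
  · rw [entry_eq _ ((hα i).le_of_lt h.1) h.1 ((hβ j).le_of_lt h.2) h.2,
      kernelElement_apply x L hr hs hu1 hu hv1 hv]
  · rw [entry_eq_zero _ h]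
    split_ifs with h1
    · obtain ⟨rfl, rfl, h2, h3⟩ := h1
      symm
      refine Finset.sum_eq_zero fun t _ => ?_
      rw [if_neg, mul_zero]
      rintro ⟨rfl, rfl⟩
      have := t.2
      refine h ⟨?_, ?_⟩
      · have := (hα L.i).le (c := L.r - 1 + t + 1) (d := L.r + L.l) (by omega) (by omega)
        omega
      · have := (hβ L.j).le (c := L.s - 1 + t + 1) (d := L.s + L.l) (by omega) (by omega)
        omega
    · rfl

theorem AdmissibleRSL.bounds {p q k r s l : ℕ} (hp : 1 ≤ p) (hq : 1 ≤ q) (hk : 1 ≤ k)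
    (h : AdmissibleRSL p q k r s l) :
    1 ≤ r ∧ 1 ≤ s ∧ (r = 1 ∨ s = 1) ∧ r ≤ k ∧ r + l ≤ p ∧ s + l ≤ q := by
  rcases h with h | h <;> omega

variable {lam : Fin a → ℂ} {mu : Fin b → ℂ} {k : ℕ}
  {x : Fin a → Fin b → ℕ → ℕ → (l : ℕ) → Fin (l + 1) → ℂ}

/-- The power `k - 1` produces ones throughout the window, so the power `k` produces their
differences, which are zero. The lower bound on `v` ends the column chain before anything beyond the
window becomes visible. -/
theorem kernelElement_mem_ker (hα : ∀ i, IsWeyrSeq (p i) (α i)) (hβ : ∀ j, IsWeyrSeq (q j) (β j))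
    (hk : 1 ≤ k) {L : Label a b} (hL : L ∈ labelSet lam mu p q α β k)
    (hx : SolvesWindow (k - 1) (k - L.r) L.l (x L.i L.j L.r L.s L.l)) :
    (phi (weyrMatrix lam p α) (weyrMatrix mu q β) ^ k) (kernelElement p q α β x L) = 0 := by
  obtain ⟨hlm, hadm, hu1, hu, hvl, hv⟩ := hL
  obtain ⟨hr, hs, hrs, hrk, hrl, hsl⟩ := hadm.bounds (hα L.i).one_le (hβ L.j).one_le hk
  have hentry := entry_kernelElement hα hβ x L hr hs hu1 hu (by omega) hv
  refine eq_zero_of_entry fun i j u v c d hu' hv' => ?_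
  rw [entry_phi_pow hα hβ lam mu k _ i j u v c d hv']
  by_cases h : L.i = i ∧ L.j = j ∧ L.u = u + 1 ∧ L.v = v + 1
  · have hF : entry (kernelElement p q α β x L) i j u v = fun c d =>
        ∑ t : Fin (L.l + 1), x L.i L.j L.r L.s L.l t *
          (if c = L.r - 1 + t ∧ d = L.s - 1 + t then 1 else 0) := by
      funext c d
      rw [hentry, if_pos h]
    obtain ⟨rfl, rfl, h3, h4⟩ := h
    rw [sub_eq_zero.mpr hlm, hF]
    by_cases hcd : d + (L.r - 1) = c + k + (L.s - 1)
    · obtain ⟨m, rfl⟩ : ∃ m, d = L.s - 1 + m := ⟨d - (L.s - 1), by omega⟩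
      rw [shiftOp_iterate_diagonal _ (r := L.r - 1) (by omega) k c m (by omega)]
      have hser : PowerSeries.mk (fun t => ∑ t' : Fin (L.l + 1), x L.i L.j L.r L.s L.l t' *
          (if L.r - 1 + t = L.r - 1 + t' ∧ L.s - 1 + t = L.s - 1 + t' then 1 else 0)) =
          coeffSeries (x L.i L.j L.r L.s L.l) := by
        ext t
        rw [coeffSeries, PowerSeries.coeff_mk, PowerSeries.coeff_mk]
        exact sum_ite_diagonal _ rfl rfl
      rw [hser]
      -- Otherwise column `d` would lie at or beyond block `1 + k - r + s + l`, whose size is less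
      -- than `v` by the choice of the label.
      have hlt : m < k + 1 - L.r + L.l := by
        by_contra hcon
        have := (hβ L.j).le (c := 1 + k - L.r + L.s + L.l) (d := L.s - 1 + m + 1)
          (by omega) (by omega)
        omega
      obtain ⟨k, rfl⟩ : ∃ k', k = k' + 1 := ⟨k - 1, by omega⟩
      obtain ⟨m, rfl⟩ : ∃ m', m = m' + 1 := ⟨m - 1, by omega⟩
      rw [Nat.add_sub_cancel] at hx
      have h1 := hx (m - (k + 1 - L.r)) (by omega)
      have h2 := hx (m + 1 - (k + 1 - L.r)) (by omega)
      rw [Nat.add_sub_cancel' (by omega)] at h1 h2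
      rw [pow_succ, ← mul_assoc, mul_sub, mul_one, map_sub, PowerSeries.coeff_succ_mul_X, h1, h2,
        sub_self]
    · exact shiftOp_iterate_offDiagonal (fun c d h => sum_ite_offDiagonal _ h) k c d hcd
  · have hF : entry (kernelElement p q α β x L) i j u v = fun _ _ => 0 := by
      funext c d
      rw [hentry, if_neg h]
    rw [hF, shiftOp_iterate_zero]

/-- The entry at the position of the last coefficient of the candidate with label `L`. -/
def leadingEntry (L : Label a b)
    (X : Matrix (Σ i : Fin a, BlockIdx (p i) (α i)) (Σ j : Fin b, BlockIdx (q j) (β j)) ℂ) : ℂ :=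
  entry X L.i L.j (L.u - 1) (L.v - 1) (L.r - 1 + L.l) (L.s - 1 + L.l)

/-- On each diagonal the labels occupy the far end, so vanishing leading entries bound the degree of
`S`. The kernel condition supplies a gap of that very length, and the gap lemma applies. -/
theorem eq_zero_of_leadingEntry (hα : ∀ i, IsWeyrSeq (p i) (α i))
    (hβ : ∀ j, IsWeyrSeq (q j) (β j))
    {X : Matrix (Σ i : Fin a, BlockIdx (p i) (α i)) (Σ j : Fin b, BlockIdx (q j) (β j)) ℂ}
    (hX : (phi (weyrMatrix lam p α) (weyrMatrix mu q β) ^ k) X = 0)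
    (h : ∀ L ∈ labelSet lam mu p q α β k, leadingEntry L X = 0) : X = 0 := by
  refine eq_zero_of_entry fun i j u v c₀ d₀ hu₀ hv₀ => ?_
  by_cases hlm : lam i = mu j
  · obtain ⟨e, he⟩ := (hα i).exists_length u
    obtain ⟨f, hf⟩ := (hβ j).exists_length v
    set r₀ := c₀ - min c₀ d₀ with hr₀
    set s₀ := d₀ - min c₀ d₀ with hs₀
    have hrs : r₀ = 0 ∨ s₀ = 0 := by omega
    have hd₀ := (hf d₀).mp hv₀
    have hser : PowerSeries.mk (fun t => entry X i j u v (r₀ + t) (s₀ + t)) = 0 := by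
      -- The product is visible from position `k - r₀` (first row, or the start of the diagonal if
      -- `k ≤ r₀`) up to the end `f - s₀` of the column chain. An entry inside the array at `t ≥ l`
      -- is the leading entry of a label.
      refine eq_zero_of_gap (c := k - r₀) (K := k) (l := f - s₀ - (k - r₀)) (by omega) _ ?_ ?_
      · intro t ht
        rw [PowerSeries.coeff_mk]
        by_cases hval : u < α i (r₀ + t + 1) ∧ v < β j (s₀ + t + 1)
        · have hrp := (hα i).le_of_lt hval.1
          have hsq := (hβ j).le_of_lt hval.2
          have htf := (hf _).mp hval.2
          have := h ⟨i, j, r₀ + 1, s₀ + 1, t, u + 1, v + 1⟩ ?_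
          · simpa [leadingEntry] using this
          · refine ⟨hlm, ?_, by simp, ?_, ?_, ?_⟩
            · simp only [AdmissibleRSL]
              omega
            · simpa only [add_right_comm, Nat.succ_le_iff] using hval.1
            · have h1 : ¬ v < β j (k - r₀ + s₀ + t + 1) := by
                rw [hf]
                omega
              have h2 : 1 + k - (r₀ + 1) + (s₀ + 1) + t = k - r₀ + s₀ + t + 1 := by omega
              simp only
              rw [h2]
              omega
            · simpa only [add_right_comm, Nat.succ_le_iff] using hval.2
        · exact entry_eq_zero X hval
      · intro m h1 h2
        have hv' : v < β j (s₀ + m + 1) := (hf _).mpr (by omega)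
        have := entry_phi_pow hα hβ lam mu k X i j u v (r₀ + m - k) (s₀ + m) hv'
        rw [hX, sub_eq_zero.mpr hlm, shiftOp_iterate_diagonal _ hrs k _ m (by omega)] at this
        rw [← this]
        simp [entry]
    have := congrArg (PowerSeries.coeff (min c₀ d₀)) hser
    rw [PowerSeries.coeff_mk, map_zero] at this
    rwa [show r₀ + min c₀ d₀ = c₀ by omega, show s₀ + min c₀ d₀ = d₀ by omega] at this
  · refine entry_eq_zero_of_ne hα hβ hlm u v k X (fun c d _ => ?_) c₀ d₀ hv₀
    rw [hX]
    simp [entry]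

/-- Triangularity in `l`: among the labels of a relation take one with maximal `l`. Another
candidate reaching its leading position shares `i`, `j`, `u`, `v` and the diagonal, hence `r` and
`s` since one of them is `1`; it then has at least the same `l`, so it is the same label. -/
theorem linearIndependent_kernelElement (hα : ∀ i, IsWeyrSeq (p i) (α i))
    (hβ : ∀ j, IsWeyrSeq (q j) (β j)) (hk : 1 ≤ k)
    (hx : ∀ i j r s l, lam i = mu j → AdmissibleRSL (p i) (q j) k r s l →
      SolvesWindow (k - 1) (k - r) l (x i j r s l)) :
    LinearIndependent ℂ (fun L : labelSet lam mu p q α β k =>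
      kernelElement p q α β x (L : Label a b)) := by
  rw [linearIndependent_iff]
  intro g hg
  by_contra hne
  obtain ⟨L, hL, hmax⟩ := Finset.exists_max_image g.support (fun L => (L : Label a b).l)
    (Finsupp.support_nonempty_iff.mpr hne)
  have h0 : leadingEntry (L : Label a b) (Finsupp.linearCombination ℂ
      (fun L : labelSet lam mu p q α β k => kernelElement p q α β x (L : Label a b)) g) = 0 := by
    rw [hg]
    simp [leadingEntry, entry]
  have hsum : leadingEntry (L : Label a b) (Finsupp.linearCombination ℂ
      (fun L : labelSet lam mu p q α β k => kernelElement p q α β x (L : Label a b)) g) =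
      ∑ L' ∈ g.support, g L' * leadingEntry (L : Label a b) (kernelElement p q α β x L') := by
    rw [Finsupp.linearCombination_apply, Finsupp.sum, leadingEntry, entry, Matrix.sum_mulVec,
      dotProduct_sum]
    refine Finset.sum_congr rfl fun L' _ => ?_
    rw [smul_mulVec, dotProduct_smul, smul_eq_mul, leadingEntry, entry]
  obtain ⟨L, hmem⟩ := L
  obtain ⟨hlm, hadm, hu1, hu, hvl, hv⟩ := hmem
  obtain ⟨hr, hs, hrs, hrk, hrl, hsl⟩ := hadm.bounds (hα L.i).one_le (hβ L.j).one_le hk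
  have hlead : leadingEntry L (kernelElement p q α β x L) =
      x L.i L.j L.r L.s L.l (Fin.last L.l) := by
    rw [leadingEntry, entry_kernelElement hα hβ x L hr hs hu1 hu (by omega) hv,
      if_pos ⟨rfl, rfl, by omega, by omega⟩, sum_ite_diagonal _ rfl rfl, dif_pos (by omega)]
    rfl
  rw [hsum, Finset.sum_eq_single_of_mem _ hL, hlead] at h0
  · have h1 := (hx _ _ _ _ _ hlm hadm).last_ne_zero (by omega)
    exact Finsupp.mem_support_iff.mp hL ((mul_eq_zero.mp h0).resolve_right h1)
  · rintro ⟨L', hmem'⟩ hL' hLL'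
    have hle : L'.l ≤ L.l := hmax _ hL'
    obtain ⟨hlm', hadm', hu1', hu', hvl', hv'⟩ := hmem'
    obtain ⟨hr', hs', hrs', hrk', hrl', hsl'⟩ :=
      hadm'.bounds (hα L'.i).one_le (hβ L'.j).one_le hk
    rw [leadingEntry, entry_kernelElement hα hβ x L' hr' hs' hu1' hu' (by omega) hv']
    split_ifs with hc
    · rw [Finset.sum_eq_zero, mul_zero]
      intro t _
      have := t.2
      rw [if_neg, mul_zero]
      rintro ⟨h1, h2⟩
      refine hLL' (Subtype.ext ?_)
      obtain ⟨h3, h4, h5, h6⟩ := hc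
      dsimp only at h1 h2 h3 h4 h5 h6
      have hr2 : L'.r = L.r := by omega
      have hs2 : L'.s = L.s := by omega
      have hl2 : L'.l = L.l := by omega
      have hu2 : L'.u = L.u := by omega
      have hv2 : L'.v = L.v := by omega
      cases L
      cases L'
      simp_all
    · rw [mul_zero]

end basis


/-! ### Counting labels and the dimension formula -/

section counting

variable {a b : ℕ} {p : Fin a → ℕ} {α : Fin a → ℕ → ℕ} {q : Fin b → ℕ} {β : Fin b → ℕ → ℕ}

/-- The triples `(r, s, l)` that can occur in a label. -/
def rslFinset (p q k : ℕ) : Finset (ℕ × ℕ × ℕ) :=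
  Finset.Icc 2 k ×ˢ {1} ×ˢ Finset.range (min p q + 1) ∪
    {1} ×ˢ Finset.Icc 1 q ×ˢ Finset.range (min p q + 1)

/-- The labels, arranged by `(i, j)` and `(r, s, l)`. -/
def labelSigma (lam : Fin a → ℂ) (mu : Fin b → ℂ) (p : Fin a → ℕ) (q : Fin b → ℕ)
    (α : Fin a → ℕ → ℕ) (β : Fin b → ℕ → ℕ) (k : ℕ) :
    Finset (Σ _ : Fin a × Fin b, Σ _ : ℕ × ℕ × ℕ, ℕ × ℕ) :=
  (Finset.univ.filter fun ij : Fin a × Fin b => lam ij.1 = mu ij.2).sigma fun ij =>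
    (rslFinset (p ij.1) (q ij.2) k).sigma fun t =>
      Finset.Icc 1 (α ij.1 (t.1 + t.2.2)) ×ˢ
        Finset.Icc (β ij.2 (1 + k - t.1 + t.2.1 + t.2.2) + 1) (β ij.2 (t.2.1 + t.2.2))

theorem labelSet_eq_image (hα : ∀ i, IsWeyrSeq (p i) (α i)) (hβ : ∀ j, IsWeyrSeq (q j) (β j))
    {k : ℕ} (hk : 1 ≤ k) (lam : Fin a → ℂ) (mu : Fin b → ℂ) :
    labelSet lam mu p q α β k = (fun x : Σ _ : Fin a × Fin b, Σ _ : ℕ × ℕ × ℕ, ℕ × ℕ =>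
      (⟨x.1.1, x.1.2, x.2.1.1, x.2.1.2.1, x.2.1.2.2, x.2.2.1, x.2.2.2⟩ : Label a b)) ''
        (labelSigma lam mu p q α β k : Set _) := by
  ext ⟨i, j, r, s, l, u, v⟩
  have hp := (hα i).one_le
  have hq := (hβ j).one_le
  constructor
  · rintro ⟨hlm, hadm, hu1, hu, hvl, hv⟩
    obtain ⟨hr, hs, hrs, hrk, hrl, hsl⟩ := hadm.bounds hp hq hk
    refine ⟨⟨(i, j), (r, s, l), (u, v)⟩, ?_, rfl⟩
    simp only at *
    simp only [labelSigma, rslFinset, Finset.mem_coe, Finset.mem_sigma, Finset.mem_filter,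
      Finset.mem_univ, true_and, Finset.mem_union, Finset.mem_product, Finset.mem_Icc,
      Finset.mem_singleton, Finset.mem_range]
    refine ⟨hlm, ?_, ⟨hu1, hu⟩, hvl, hv⟩
    omega
  · rintro ⟨⟨⟨i, j⟩, ⟨r, s, l⟩, ⟨u, v⟩⟩, h, h2⟩
    simp only [Label.mk.injEq] at h2
    obtain ⟨rfl, rfl, rfl, rfl, rfl, rfl, rfl⟩ := h2
    simp only [labelSigma, rslFinset, Finset.mem_coe, Finset.mem_sigma, Finset.mem_filter,
      Finset.mem_univ, true_and, Finset.mem_union, Finset.mem_product, Finset.mem_Icc,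
      Finset.mem_singleton, Finset.mem_range] at h
    obtain ⟨hlm, h, ⟨hu1, hu⟩, hvl, hv⟩ := h
    refine ⟨hlm, ?_, hu1, hu, hvl, hv⟩
    -- The box of triples is larger than the admissible range, but surplus triples carry no pair
    -- `(u, v)`: a nonempty range forces `r + l ≤ p i` and `s + l ≤ q j`.
    have h1 := (hα i).le_of_lt (u := 0) (c := r + l) (by omega)
    have h2 := (hβ j).le_of_lt (u := 0) (c := s + l) (by omega)
    simp only [AdmissibleRSL]
    omega

/-- Telescoping. It converts the count over the `q` diagonals with `r = 1` into the sum up to `k` in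
`dimNumber`. -/
theorem sum_Icc_sub_shift {q : ℕ} (g : ℕ → ℤ) (hg : ∀ s, q < s → g s = 0) (k : ℕ) :
    ∑ s ∈ Finset.Icc 1 q, (g s - g (s + k)) = ∑ s ∈ Finset.Icc 1 k, g s := by
  induction k with
  | zero => simp
  | succ k ih =>
    rw [Finset.sum_Icc_succ_top (by omega), ← ih, ← sub_eq_iff_eq_add', ← Finset.sum_sub_distrib]
    have : ∀ n, ∑ s ∈ Finset.Icc 1 n, (g (s + k) - g (s + k + 1)) = g (k + 1) - g (n + k + 1) := by
      intro n
      induction n with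
      | zero => simp
      | succ n ihn =>
        rw [Finset.sum_Icc_succ_top (by omega), ihn, show n + 1 + k = n + k + 1 by omega]
        ring
    rw [Finset.sum_congr rfl (g := fun s => g (s + k) - g (s + k + 1)), this,
      hg (q + k + 1) (by omega), sub_zero]
    intro s _
    rw [← add_assoc]
    ring

theorem sum_rslFinset {p q : ℕ} {γ δ : ℕ → ℕ} (hδ : IsWeyrSeq q δ) (k : ℕ) :
    ∑ t ∈ rslFinset p q k, (γ (t.1 + t.2.2) : ℤ) *
      ((δ (t.2.1 + t.2.2) : ℤ) - δ (1 + k - t.1 + t.2.1 + t.2.2)) = dimNumber p q γ δ k := by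
  rw [rslFinset, Finset.sum_union, dimNumber]
  · congr 1
    · rw [Finset.sum_product]
      refine Finset.sum_congr rfl fun r hr => ?_
      rw [Finset.sum_product, Finset.sum_singleton]
      refine Finset.sum_congr rfl fun l _ => ?_
      simp only
      have := Finset.mem_Icc.mp hr
      rw [show 1 + k - r + 1 + l = 2 + k - r + l by omega]
    · rw [Finset.sum_product, Finset.sum_singleton, Finset.sum_product, Finset.sum_comm]
      refine Finset.sum_congr rfl fun l _ => ?_
      simp only
      rw [← Finset.mul_sum, ← sum_Icc_sub_shift (q := q) (fun s => (δ (s + l) : ℤ))]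
      · congr 1
        refine Finset.sum_congr rfl fun s _ => ?_
        rw [show 1 + k - 1 + s + l = s + k + l by omega]
      · intro s hs
        rw [hδ.eq_zero _ (by omega)]
        rfl
  · rw [Finset.disjoint_left]
    rintro ⟨r, s, l⟩ h1 h2
    simp only [Finset.mem_product, Finset.mem_Icc, Finset.mem_singleton] at h1 h2
    omega

theorem card_labelSigma (hβ : ∀ j, IsWeyrSeq (q j) (β j)) (lam : Fin a → ℂ) (mu : Fin b → ℂ)
    (k : ℕ) :
    ((labelSigma lam mu p q α β k).card : ℤ) =
      ∑ i, ∑ j, if lam i = mu j then dimNumber (p i) (q j) (α i) (β j) k else 0 := by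
  rw [labelSigma, Finset.card_sigma, Nat.cast_sum, Finset.sum_filter, ← Finset.univ_product_univ,
    Finset.sum_product]
  refine Finset.sum_congr rfl fun i _ => Finset.sum_congr rfl fun j _ => ?_
  simp only
  split_ifs
  · rw [← sum_rslFinset (hβ j), Finset.card_sigma, Nat.cast_sum]
    refine Finset.sum_congr rfl fun t ht => ?_
    have h1 : 1 ≤ t.2.1 ∧ t.1 ≤ 1 + k := by
      rcases Finset.mem_union.mp ht with ht | ht <;>
        simp only [Finset.mem_product, Finset.mem_Icc, Finset.mem_singleton] at ht <;> omega
    have h2 : β j (1 + k - t.1 + t.2.1 + t.2.2) ≤ β j (t.2.1 + t.2.2) :=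
      (hβ j).le (by omega) (by omega)
    rw [Finset.card_product, Nat.card_Icc, Nat.card_Icc, Nat.cast_mul, Nat.add_sub_cancel,
      Nat.add_sub_add_right, Nat.cast_sub h2]
  · rfl

theorem finite_labelSet (hα : ∀ i, IsWeyrSeq (p i) (α i)) (hβ : ∀ j, IsWeyrSeq (q j) (β j))
    {k : ℕ} (hk : 1 ≤ k) (lam : Fin a → ℂ) (mu : Fin b → ℂ) :
    (labelSet lam mu p q α β k).Finite := by
  rw [labelSet_eq_image hα hβ hk]
  exact (Finset.finite_toSet _).image _

theorem card_labelSet (hα : ∀ i, IsWeyrSeq (p i) (α i)) (hβ : ∀ j, IsWeyrSeq (q j) (β j))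
    {k : ℕ} (hk : 1 ≤ k) (lam : Fin a → ℂ) (mu : Fin b → ℂ) :
    (Nat.card (labelSet lam mu p q α β k) : ℤ) =
      ∑ i, ∑ j, if lam i = mu j then dimNumber (p i) (q j) (α i) (β j) k else 0 := by
  rw [← card_labelSigma hβ, labelSet_eq_image hα hβ hk, Nat.card_image_of_injective]
  · simp
  · rintro ⟨⟨i, j⟩, ⟨r, s, l⟩, ⟨u, v⟩⟩ ⟨⟨i', j'⟩, ⟨r', s', l'⟩, ⟨u', v'⟩⟩ h
    simp only [Label.mk.injEq] at h
    obtain ⟨rfl, rfl, rfl, rfl, rfl, rfl, rfl⟩ := h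
    rfl

/-- For coefficients solving the window equations, the candidates form a basis of the kernel. -/
theorem span_kernelElement (hα : ∀ i, IsWeyrSeq (p i) (α i)) (hβ : ∀ j, IsWeyrSeq (q j) (β j))
    {k : ℕ} (hk : 1 ≤ k) {lam : Fin a → ℂ} {mu : Fin b → ℂ}
    {x : Fin a → Fin b → ℕ → ℕ → (l : ℕ) → Fin (l + 1) → ℂ}
    (hx : ∀ i j r s l, lam i = mu j → AdmissibleRSL (p i) (q j) k r s l →
      SolvesWindow (k - 1) (k - r) l (x i j r s l)) :
    Submodule.span ℂ (kernelElement p q α β x '' labelSet lam mu p q α β k) =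
        LinearMap.ker (phi (weyrMatrix lam p α) (weyrMatrix mu q β) ^ k) ∧
      Module.finrank ℂ (LinearMap.ker (phi (weyrMatrix lam p α) (weyrMatrix mu q β) ^ k)) =
        Nat.card (labelSet lam mu p q α β k) := by
  set S := labelSet lam mu p q α β k
  set W := LinearMap.ker (phi (weyrMatrix lam p α) (weyrMatrix mu q β) ^ k)
  have : Finite S := finite_labelSet hα hβ hk lam mu
  have : Fintype S := Fintype.ofFinite S
  have hle : Submodule.span ℂ (kernelElement p q α β x '' S) ≤ W := by
    rw [Submodule.span_le]
    rintro _ ⟨L, hL, rfl⟩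
    exact kernelElement_mem_ker hα hβ hk hL (hx _ _ _ _ _ hL.1 hL.2.1)
  have hspan : Module.finrank ℂ (Submodule.span ℂ (kernelElement p q α β x '' S)) =
      Nat.card S := by
    have := finrank_span_eq_card (linearIndependent_kernelElement hα hβ hk hx)
    rwa [← Nat.card_eq_fintype_card, Set.range_comp', Subtype.range_coe] at this
  -- Independence bounds the dimension of the kernel from below by the number of labels; this map,
  -- injective by `eq_zero_of_leadingEntry`, bounds it from above.
  let T : W →ₗ[ℂ] (S → ℂ) :=
    { toFun := fun X L => leadingEntry (L : Label a b) X.1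
      map_add' := by
        intro X Y
        ext L
        simp [leadingEntry, entry, Matrix.add_mulVec, dotProduct_add]
      map_smul' := by
        intro c X
        ext L
        simp [leadingEntry, entry, Matrix.smul_mulVec, dotProduct_smul] }
  have hinj : Function.Injective T := by
    rw [injective_iff_map_eq_zero]
    intro X hX
    exact Subtype.ext (eq_zero_of_leadingEntry hα hβ X.2 fun L hL => congrFun hX ⟨L, hL⟩)
  have hcard : Module.finrank ℂ W ≤ Nat.card S := by
    have := LinearMap.finrank_le_finrank_of_injective hinj
    rwa [Module.finrank_fintype_fun_eq_card, ← Nat.card_eq_fintype_card] at this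
  have heq := Submodule.eq_of_le_of_finrank_le hle (hspan ▸ hcard)
  exact ⟨heq, heq ▸ hspan⟩

theorem finrank_ker_phi_weyrMatrix (hα : ∀ i, IsWeyrSeq (p i) (α i))
    (hβ : ∀ j, IsWeyrSeq (q j) (β j)) {k : ℕ} (hk : 1 ≤ k) (lam : Fin a → ℂ) (mu : Fin b → ℂ) :
    (Module.finrank ℂ (LinearMap.ker
        (phi (weyrMatrix lam p α) (weyrMatrix mu q β) ^ k)) : ℤ) =
      ∑ i, ∑ j, if lam i = mu j then dimNumber (p i) (q j) (α i) (β j) k else 0 := by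
  rw [← card_labelSet hα hβ hk]
  have hex : ∀ r l, ∃ x : Fin (l + 1) → ℂ, 1 ≤ r → SolvesWindow (k - 1) (k - r) l x := by
    intro r l
    by_cases hr : 1 ≤ r
    · obtain ⟨x, hx, -⟩ := existsUnique_solvesWindow (show k - r ≤ k - 1 by omega) l
      exact ⟨x, fun _ => hx⟩
    · exact ⟨0, fun h => absurd h hr⟩
  choose x hx using hex
  refine congrArg _ (span_kernelElement hα hβ hk (x := fun _ _ r _ l => x r l) ?_).2
  intro i j r s l _ hadm
  exact hx r l (hadm.bounds (hα i).one_le (hβ j).one_le hk).1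

end counting

/-! ### Nullities, Weyr characteristic and existence of the Weyr form -/

section linearAlgebra

variable {V : Type*} [AddCommGroup V] [Module ℂ V]

theorem ker_pow_mono (g : Module.End ℂ V) {k l : ℕ} (h : k ≤ l) :
    LinearMap.ker (g ^ k) ≤ LinearMap.ker (g ^ l) := by
  intro v hv
  rw [LinearMap.mem_ker] at hv ⊢
  rw [← Nat.sub_add_cancel h, pow_add, Module.End.mul_apply, hv, map_zero]

/-- The space `ker g ∩ range (g ^ k)`. -/
def kerRange (g : Module.End ℂ V) (k : ℕ) : Submodule ℂ V :=
  LinearMap.ker g ⊓ LinearMap.range (g ^ k)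

theorem kerRange_antitone (g : Module.End ℂ V) : Antitone (kerRange g) := by
  intro k l h
  refine inf_le_inf_left _ ?_
  rintro _ ⟨v, rfl⟩
  refine ⟨(g ^ (l - k)) v, ?_⟩
  rw [← Module.End.mul_apply, ← pow_add, Nat.add_sub_cancel' h]

theorem map_ker_pow_succ (g : Module.End ℂ V) (k : ℕ) :
    (LinearMap.ker (g ^ (k + 1))).map (g ^ k) = kerRange g k := by
  ext w
  simp only [kerRange, Submodule.mem_map, LinearMap.mem_ker, Submodule.mem_inf,
    LinearMap.mem_range]
  constructor
  · rintro ⟨v, hv, rfl⟩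
    rw [pow_succ', Module.End.mul_apply] at hv
    exact ⟨hv, v, rfl⟩
  · rintro ⟨hw, v, rfl⟩
    refine ⟨v, ?_, rfl⟩
    rw [pow_succ', Module.End.mul_apply, hw]

theorem nullity_zero (f : Module.End ℂ V) (z : ℂ) : nullity f z 0 = 0 := by
  rw [nullity, pow_zero, Module.End.one_eq_id, LinearMap.ker_id, finrank_bot]

theorem weyrIndex_le {f : Module.End ℂ V} {z : ℂ} {k : ℕ} (hk : 1 ≤ k)
    (h : nullity f z k = nullity f z (k + 1)) : weyrIndex f z ≤ k :=
  Nat.sInf_le ⟨hk, h⟩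

variable [FiniteDimensional ℂ V]

/-- Rank-nullity for `g ^ k` restricted to `ker (g ^ (k + 1))`, whose image is `kerRange g k`. Weyr
numbers thus become dimensions of a descending chain, which makes them decreasing. -/
theorem finrank_ker_pow_succ (g : Module.End ℂ V) (k : ℕ) :
    Module.finrank ℂ (LinearMap.ker (g ^ (k + 1))) =
      Module.finrank ℂ (LinearMap.ker (g ^ k)) + Module.finrank ℂ (kerRange g k) := by
  have h := LinearMap.finrank_range_add_finrank_ker
    ((g ^ k).domRestrict (LinearMap.ker (g ^ (k + 1))))
  rw [LinearMap.range_domRestrict, map_ker_pow_succ, LinearMap.ker_domRestrict] at h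
  rw [← h, add_comm, (Submodule.comapSubtypeEquivOfLe
    (ker_pow_mono g (Nat.le_succ k))).finrank_eq]

theorem nullity_succ (f : Module.End ℂ V) (z : ℂ) (k : ℕ) :
    nullity f z (k + 1) =
      nullity f z k + Module.finrank ℂ (kerRange (f - z • (1 : Module.End ℂ V)) k) :=
  finrank_ker_pow_succ _ k

theorem nullity_mono (f : Module.End ℂ V) (z : ℂ) : Monotone (nullity f z) :=
  monotone_nat_of_le_succ fun k => by rw [nullity_succ]; exact Nat.le_add_right _ _

theorem nullity_le (f : Module.End ℂ V) (z : ℂ) (k : ℕ) : nullity f z k ≤ Module.finrank ℂ V :=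
  Submodule.finrank_le _

theorem nullity_eq_of_le {f : Module.End ℂ V} {z : ℂ} {k : ℕ}
    (h : nullity f z k = nullity f z (k + 1)) {l : ℕ} (hl : k ≤ l) :
    nullity f z l = nullity f z k := by
  have h0 : Module.finrank ℂ (kerRange (f - z • (1 : Module.End ℂ V)) k) = 0 := by
    have := nullity_succ f z k
    omega
  induction l, hl using Nat.le_induction with
  | base => rfl
  | succ l hl ih =>
    have := Submodule.finrank_mono (kerRange_antitone (f - z • (1 : Module.End ℂ V)) hl)
    rw [nullity_succ, ih]
    omega

theorem exists_nullity_eq (f : Module.End ℂ V) (z : ℂ) :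
    nullity f z (Module.finrank ℂ V) = nullity f z (Module.finrank ℂ V + 1) := by
  by_contra hne
  -- A standstill at any earlier step would persist, so the nullity would grow at each of the first
  -- `finrank + 1` steps and exceed the dimension.
  have hlt : ∀ k ≤ Module.finrank ℂ V + 1, k ≤ nullity f z k := by
    intro k
    induction k with
    | zero => simp
    | succ k ih =>
      intro hk
      have h1 := ih (by omega)
      have h2 := nullity_succ f z k
      by_contra hcon
      have h3 : nullity f z k = nullity f z (k + 1) := by omega
      apply hne
      rw [nullity_eq_of_le h3 (show k ≤ Module.finrank ℂ V by omega),
        nullity_eq_of_le h3 (show k ≤ Module.finrank ℂ V + 1 by omega)]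
  have h1 := hlt _ le_rfl
  have h2 := nullity_le f z (Module.finrank ℂ V + 1)
  omega

theorem nullity_eq_nullity_finrank (f : Module.End ℂ V) (z : ℂ) {k : ℕ}
    (hk : Module.finrank ℂ V ≤ k) : nullity f z k = nullity f z (Module.finrank ℂ V) :=
  nullity_eq_of_le (exists_nullity_eq f z) hk

theorem weyrIndex_spec (f : Module.End ℂ V) (z : ℂ) :
    0 < weyrIndex f z ∧ nullity f z (weyrIndex f z) = nullity f z (weyrIndex f z + 1) := by
  -- The witness is `finrank + 1` because `finrank` itself may be `0` and the index must be
  -- positive.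
  refine Nat.sInf_mem (s := {q : ℕ | 0 < q ∧ nullity f z q = nullity f z (q + 1)})
    ⟨Module.finrank ℂ V + 1, Nat.succ_pos _, ?_⟩
  rw [nullity_eq_nullity_finrank f z (Nat.le_succ _),
    nullity_eq_nullity_finrank f z (show _ ≤ Module.finrank ℂ V + 1 + 1 by omega)]

theorem weyrChar_eq (f : Module.End ℂ V) (z : ℂ) (k : ℕ) :
    weyrChar f z k = nullity f z k - nullity f z (k - 1) := by
  rw [weyrChar]
  split_ifs with h
  · rfl
  · have h1 := nullity_eq_of_le (weyrIndex_spec f z).2 (show weyrIndex f z ≤ k by omega)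
    have h2 := nullity_eq_of_le (weyrIndex_spec f z).2 (show weyrIndex f z ≤ k - 1 by omega)
    omega

theorem weyrChar_succ (f : Module.End ℂ V) (z : ℂ) (k : ℕ) :
    weyrChar f z (k + 1) = Module.finrank ℂ (kerRange (f - z • (1 : Module.End ℂ V)) k) := by
  rw [weyrChar_eq, Nat.add_sub_cancel, nullity_succ, Nat.add_sub_cancel_left]

theorem isWeyrSeq_weyrChar (f : Module.End ℂ V) (z : ℂ) :
    IsWeyrSeq (weyrIndex f z) (weyrChar f z) where
  one_le := (weyrIndex_spec f z).1
  antitone c hc := by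
    obtain ⟨c, rfl⟩ : ∃ c', c = c' + 1 := ⟨c - 1, by omega⟩
    rw [weyrChar_succ, weyrChar_succ]
    exact Submodule.finrank_mono (kerRange_antitone _ (Nat.le_succ c))
  eq_zero c hc := by rw [weyrChar, if_neg (not_le.mpr hc)]

theorem nullity_one_pos_iff (f : Module.End ℂ V) (z : ℂ) :
    0 < nullity f z 1 ↔ Module.End.HasEigenvalue f z := by
  rw [nullity, pow_one, Module.End.hasEigenvalue_iff, Module.End.eigenspace_def,
    Module.finrank_pos_iff, Submodule.nontrivial_iff_ne_bot]

theorem weyrChar_weyrIndex_pos {f : Module.End ℂ V} {z : ℂ} (h : Module.End.HasEigenvalue f z) :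
    0 < weyrChar f z (weyrIndex f z) := by
  obtain ⟨h1, h2⟩ := weyrIndex_spec f z
  rw [weyrChar_eq]
  by_contra hcon
  have hmono := nullity_mono f z (Nat.sub_le (weyrIndex f z) 1)
  by_cases h3 : weyrIndex f z = 1
  · have h4 := (nullity_one_pos_iff f z).mpr h
    rw [h3, nullity_zero] at hcon
    omega
  · have := weyrIndex_le (f := f) (z := z) (k := weyrIndex f z - 1) (by omega) (by
      rw [Nat.sub_add_cancel h1]
      omega)
    omega

theorem ker_pow_weyrIndex (f : Module.End ℂ V) (z : ℂ) :
    LinearMap.ker ((f - z • (1 : Module.End ℂ V)) ^ weyrIndex f z) = f.maxGenEigenspace z := by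
  apply le_antisymm
  · intro v hv
    exact (f.mem_maxGenEigenspace z v).mpr ⟨_, hv⟩
  · intro v hv
    obtain ⟨k, hk⟩ := (f.mem_maxGenEigenspace z v).mp hv
    rcases le_total k (weyrIndex f z) with h | h
    · exact ker_pow_mono _ h hk
    · rw [Submodule.eq_of_le_of_finrank_eq (ker_pow_mono _ h)
        (nullity_eq_of_le (weyrIndex_spec f z).2 h).symm]
      exact hk

/-- Extending a spanning sequence from a subspace to a larger one. -/
theorem exists_extend_span {W W' : Submodule ℂ V} (hW : W ≤ W') (w : ℕ → V)
    (hw : Submodule.span ℂ (w '' Set.Iio (Module.finrank ℂ W)) = W) :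
    ∃ w' : ℕ → V, (∀ t < Module.finrank ℂ W, w' t = w t) ∧
      Submodule.span ℂ (w' '' Set.Iio (Module.finrank ℂ W')) = W' := by
  obtain ⟨C, hC⟩ := W.exists_isCompl
  -- By the modular law this is a complement of `W` inside `W'`; a basis of it is appended after the
  -- first `finrank W` terms, so one sequence serves the whole chain of subspaces by initial
  -- segments.
  set U := C ⊓ W' with hU
  have hsup : W ⊔ U = W' := by
    rw [hU, ← sup_inf_assoc_of_le C hW, hC.sup_eq_top, top_inf_eq]
  have hinf : W ⊓ U = ⊥ := by
    rw [hU, ← inf_assoc, hC.inf_eq_bot, bot_inf_eq]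
  have hdim : Module.finrank ℂ W' = Module.finrank ℂ W + Module.finrank ℂ U := by
    have := Submodule.finrank_sup_add_finrank_inf_eq W U
    rwa [hsup, hinf, finrank_bot, add_zero] at this
  let B := Module.finBasis ℂ U
  refine ⟨fun t => if t < Module.finrank ℂ W then w t else
    if h : t - Module.finrank ℂ W < Module.finrank ℂ U then (B ⟨_, h⟩ : V) else 0,
    fun t ht => if_pos ht, ?_⟩
  apply le_antisymm
  · rw [Submodule.span_le]
    rintro _ ⟨t, -, rfl⟩
    simp only
    split_ifs with h1 h2
    · apply hW
      rw [← hw]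
      exact Submodule.subset_span ⟨t, h1, rfl⟩
    · exact inf_le_right (a := C) (B ⟨_, h2⟩).2
    · exact W'.zero_mem
  · conv_lhs => rw [← hsup]
    refine sup_le ?_ ?_
    · conv_lhs => rw [← hw]
      refine Submodule.span_mono ?_
      rintro _ ⟨t, ht, rfl⟩
      exact ⟨t, Set.mem_Iio.mpr (by have := Set.mem_Iio.mp ht; omega), if_pos ht⟩
    · have hUspan : U = Submodule.span ℂ (Set.range fun t => (B t : V)) := by
        have := congrArg (Submodule.map U.subtype) B.span_eq
        rw [Submodule.map_span, Submodule.map_top, Submodule.range_subtype, ← Set.range_comp]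
          at this
        exact this.symm
      conv_lhs => rw [hUspan]
      refine Submodule.span_mono ?_
      rintro _ ⟨t, rfl⟩
      refine ⟨Module.finrank ℂ W + t, Set.mem_Iio.mpr (by have := t.2; omega), ?_⟩
      have h1 : Module.finrank ℂ W + (t : ℕ) - Module.finrank ℂ W = t := by omega
      simp [h1]

/-- A sequence adapted to a descending chain of subspaces. -/
theorem exists_adapted_span (R : ℕ → Submodule ℂ V) (hR : Antitone R) {p : ℕ} (hp : R p = ⊥) :
    ∃ w : ℕ → V, ∀ c, Submodule.span ℂ (w '' Set.Iio (Module.finrank ℂ (R c))) = R c := by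
  have key : ∀ n ≤ p, ∃ w : ℕ → V, ∀ c, p - n ≤ c →
      Submodule.span ℂ (w '' Set.Iio (Module.finrank ℂ (R c))) = R c := by
    intro n
    induction n with
    | zero =>
      intro _
      refine ⟨fun _ => 0, fun c hc => ?_⟩
      have : R c = ⊥ := le_bot_iff.mp (hp ▸ hR hc)
      rw [this, finrank_bot]
      simp
    | succ n ih =>
      intro hn
      obtain ⟨w, hw⟩ := ih (by omega)
      obtain ⟨w', h1, h2⟩ := exists_extend_span (hR (show p - (n + 1) ≤ p - n by omega)) w
        (hw _ le_rfl)
      refine ⟨w', fun c hc => ?_⟩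
      by_cases h : c = p - (n + 1)
      · rw [h, h2]
      · rw [← Set.image_congr (g := w') (f := w), hw c (by omega)]
        intro t ht
        exact (h1 t ((Set.mem_Iio.mp ht).trans_le
          (Submodule.finrank_mono (hR (show p - n ≤ c by omega))))).symm
  obtain ⟨w, hw⟩ := key p le_rfl
  exact ⟨w, fun c => hw c (by omega)⟩

/-- Weyr chains for one eigenvalue. -/
theorem exists_weyrChains (g : Module.End ℂ V) {p : ℕ} (hp : kerRange g p = ⊥) :
    ∃ b : ℕ → ℕ → V,
      (∀ c t, t < Module.finrank ℂ (kerRange g (c + 1)) → g (b (c + 1) t) = b c t) ∧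
      (∀ t, t < Module.finrank ℂ (kerRange g 0) → g (b 0 t) = 0) ∧
      (∀ c t, t < Module.finrank ℂ (kerRange g c) → (g ^ (c + 1)) (b c t) = 0) ∧
      ∀ c, LinearMap.ker (g ^ c) ≤ Submodule.span ℂ
        {v | ∃ i t, i < c ∧ t < Module.finrank ℂ (kerRange g i) ∧ v = b i t} := by
  classical
  obtain ⟨w, hw⟩ := exists_adapted_span (kerRange g) (kerRange_antitone g) hp
  have hanti : ∀ {c d t : ℕ}, c ≤ d → t < Module.finrank ℂ (kerRange g d) →
      t < Module.finrank ℂ (kerRange g c) :=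
    fun h ht => ht.trans_le (Submodule.finrank_mono (kerRange_antitone g h))
  have hmem : ∀ c t, t < Module.finrank ℂ (kerRange g c) → w t ∈ kerRange g c := by
    intro c t ht
    rw [← hw c]
    exact Submodule.subset_span ⟨t, ht, rfl⟩
  -- Each `w t` is pulled back once, through the largest power `g ^ e` available to it. The whole
  -- chain then consists of images of that single top vector, so consecutive members are
  -- automatically related by `g`.
  have htop : ∀ t, ∃ y : V, ∃ e : ℕ, t < Module.finrank ℂ (kerRange g 0) →
      (g ^ e) y = w t ∧ ∀ c, t < Module.finrank ℂ (kerRange g c) → c ≤ e := by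
    intro t
    by_cases ht : t < Module.finrank ℂ (kerRange g 0)
    · have hbound : ∀ c, t < Module.finrank ℂ (kerRange g c) → c ≤ p := by
        intro c hc
        by_contra hcon
        have := hanti (not_le.mp hcon).le hc
        rw [hp, finrank_bot] at this
        exact Nat.not_lt_zero _ this
      set e := Nat.findGreatest (fun c => t < Module.finrank ℂ (kerRange g c)) p with he
      have h1 : t < Module.finrank ℂ (kerRange g e) :=
        Nat.findGreatest_spec (P := fun c => t < Module.finrank ℂ (kerRange g c)) (Nat.zero_le p) ht
      obtain ⟨y, hy⟩ := (hmem e t h1).2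
      exact ⟨y, e, fun _ => ⟨hy, fun c hc => Nat.le_findGreatest (hbound c hc) hc⟩⟩
    · exact ⟨0, 0, fun h => absurd h ht⟩
  choose y e hye using htop
  set b : ℕ → ℕ → V := fun c t => (g ^ (e t - c)) (y t) with hb
  have hbw : ∀ c t, t < Module.finrank ℂ (kerRange g c) → (g ^ c) (b c t) = w t := by
    intro c t ht
    obtain ⟨h1, h2⟩ := hye t (hanti (Nat.zero_le c) ht)
    rw [hb, ← h1, ← Module.End.mul_apply, ← pow_add, Nat.add_sub_cancel' (h2 c ht)]
  have hker : ∀ c t, t < Module.finrank ℂ (kerRange g c) → (g ^ (c + 1)) (b c t) = 0 := by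
    intro c t ht
    rw [pow_succ', Module.End.mul_apply, hbw c t ht]
    exact (hmem c t ht).1
  refine ⟨b, ?_, ?_, hker, ?_⟩
  · intro c t ht
    obtain ⟨h1, h2⟩ := hye t (hanti (Nat.zero_le _) ht)
    have := h2 _ ht
    simp only [hb]
    rw [← Module.End.mul_apply, ← pow_succ', show e t - (c + 1) + 1 = e t - c by omega]
  · intro t ht
    simpa using hker 0 t ht
  · intro c
    induction c with
    | zero => simp [Module.End.one_eq_id]
    | succ c ih =>
      intro v hv
      set S := Submodule.span ℂ {v | ∃ i t, i < c + 1 ∧ t < Module.finrank ℂ (kerRange g i) ∧ v = b i t}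
        with hS
      have hcS : LinearMap.ker (g ^ c) ≤ S := by
        refine ih.trans (Submodule.span_mono ?_)
        rintro _ ⟨i, t, hi, ht, rfl⟩
        exact ⟨i, t, by omega, ht, rfl⟩
      -- The vectors `(g ^ c) (b c t) = w t` span `kerRange g c`, which contains `(g ^ c) v`;
      -- subtracting a matching combination leaves an element of `ker (g ^ c)`, covered by
      -- induction.
      have h1 : (g ^ c) v ∈ S.map (g ^ c) := by
        have h2 : (g ^ c) v ∈ kerRange g c := by
          rw [← map_ker_pow_succ]
          exact Submodule.mem_map_of_mem hv
        rw [← hw c] at h2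
        refine Submodule.span_le.mpr ?_ h2
        rintro _ ⟨t, ht, rfl⟩
        exact ⟨b c t, Submodule.subset_span ⟨c, t, by omega, ht, rfl⟩, hbw c t ht⟩
      obtain ⟨s, hs, hsv⟩ := h1
      have h3 : v - s ∈ LinearMap.ker (g ^ c) := by
        rw [LinearMap.mem_ker, map_sub, hsv, sub_self]
      have := S.add_mem (hcS h3) hs
      rwa [sub_add_cancel] at this

theorem kerRange_weyrIndex (f : Module.End ℂ V) (z : ℂ) :
    kerRange (f - z • (1 : Module.End ℂ V)) (weyrIndex f z) = ⊥ := by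
  rw [← Submodule.finrank_eq_zero, ← weyrChar_succ]
  exact (isWeyrSeq_weyrChar f z).eq_zero _ (Nat.lt_succ_self _)

theorem sum_weyrChar (f : Module.End ℂ V) (z : ℂ) (k : ℕ) :
    ∑ c : Fin k, weyrChar f z (c + 1) = nullity f z k := by
  induction k with
  | zero => simp [nullity_zero]
  | succ k ih =>
    rw [Fin.sum_univ_castSucc, nullity_succ, ← weyrChar_succ, ← ih]
    rfl

/-- A basis of a generalized eigenspace consisting of Weyr chains. -/
theorem exists_basis_maxGenEigenspace (f : Module.End ℂ V) (z : ℂ) :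
    ∃ (b : ℕ → ℕ → V)
      (B : Module.Basis (BlockIdx (weyrIndex f z) (weyrChar f z)) ℂ (f.maxGenEigenspace z)),
      (∀ x, (B x : V) = b x.1 x.2) ∧
      (∀ t, t < weyrChar f z 1 → f (b 0 t) = z • b 0 t) ∧
      (∀ c t, t < weyrChar f z (c + 2) → f (b (c + 1) t) = z • b (c + 1) t + b c t) := by
  set g := f - z • (1 : Module.End ℂ V) with hg
  have hfg : ∀ v, f v = z • v + g v := by
    intro v
    simp [hg]
  obtain ⟨b, h1, h2, h3, h4⟩ := exists_weyrChains g (kerRange_weyrIndex f z)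
  have hmem : ∀ x : BlockIdx (weyrIndex f z) (weyrChar f z),
      b x.1 x.2 ∈ f.maxGenEigenspace z := by
    intro x
    rw [Module.End.mem_maxGenEigenspace]
    exact ⟨_, h3 x.1 x.2 (by rw [← weyrChar_succ]; exact x.2.2)⟩
  have hspan : ⊤ ≤ Submodule.span ℂ (Set.range fun x => (⟨b x.1 x.2, hmem x⟩ :
      f.maxGenEigenspace z)) := by
    rintro ⟨v, hv⟩ -
    have hv' := hv
    rw [← ker_pow_weyrIndex] at hv'
    have h5 : v ∈ (Submodule.span ℂ (Set.range fun x => (⟨b x.1 x.2, hmem x⟩ :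
        f.maxGenEigenspace z))).map (f.maxGenEigenspace z).subtype := by
      rw [Submodule.map_span]
      refine Submodule.span_mono ?_ (h4 _ hv')
      rintro _ ⟨i, t, hi, ht, rfl⟩
      rw [← weyrChar_succ] at ht
      exact ⟨⟨b i t, hmem ⟨⟨i, hi⟩, ⟨t, ht⟩⟩⟩, ⟨⟨⟨i, hi⟩, ⟨t, ht⟩⟩, rfl⟩, rfl⟩
    obtain ⟨w, hw, hwv⟩ := h5
    rwa [show (⟨v, hv⟩ : f.maxGenEigenspace z) = w from Subtype.ext hwv.symm]
  have hcard : Fintype.card (BlockIdx (weyrIndex f z) (weyrChar f z)) =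
      Module.finrank ℂ (f.maxGenEigenspace z) := by
    rw [Fintype.card_sigma, ← ker_pow_weyrIndex]
    simp only [Fintype.card_fin]
    exact sum_weyrChar f z _
  refine ⟨b, basisOfTopLeSpanOfCardEqFinrank _ hspan hcard, ?_, ?_, ?_⟩
  · intro x
    rw [coe_basisOfTopLeSpanOfCardEqFinrank]
  · intro t ht
    rw [weyrChar_succ] at ht
    rw [hfg, h2 t ht, add_zero]
  · intro c t ht
    rw [weyrChar_succ] at ht
    rw [hfg, h1 c t ht]

theorem nullity_eq_zero {f : Module.End ℂ V} {z : ℂ} (hz : ¬ f.HasEigenvalue z) (k : ℕ) :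
    nullity f z k = 0 := by
  have h1 : nullity f z 1 = 0 := by
    by_contra h
    exact hz ((nullity_one_pos_iff f z).mp (Nat.pos_of_ne_zero h))
  have h2 : nullity f z 0 = nullity f z (0 + 1) := by rw [h1, nullity_zero]
  rw [nullity_eq_of_le h2 (Nat.zero_le _), nullity_zero]

theorem isInternal_maxGenEigenspace (f : Module.End ℂ V) {a : ℕ} {lam : Fin a → ℂ}
    (hlam : Function.Injective lam) (hrange : Set.range lam = {z | f.HasEigenvalue z}) :
    DirectSum.IsInternal fun i => f.maxGenEigenspace (lam i) := by
  refine DirectSum.isInternal_submodule_of_iSupIndep_of_iSup_eq_top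
    (f.independent_maxGenEigenspace.comp hlam) ?_
  rw [eq_top_iff, ← f.iSup_maxGenEigenspace_eq_top]
  refine iSup_le fun z => ?_
  by_cases hz : f.HasEigenvalue z
  · obtain ⟨i, rfl⟩ : z ∈ Set.range lam := hrange ▸ hz
    exact le_iSup (fun i => f.maxGenEigenspace (lam i)) i
  · have h0 : f.maxGenEigenspace z = ⊥ := by
      rw [← ker_pow_weyrIndex, ← Submodule.finrank_eq_zero]
      exact nullity_eq_zero hz _
    rw [h0]
    exact bot_le

/-- Existence of the Weyr canonical form. -/
theorem exists_basis_toMatrix_eq_weyrMatrix (f : Module.End ℂ V) {a : ℕ} {lam : Fin a → ℂ}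
    (hlam : Function.Injective lam) (hrange : Set.range lam = {z | f.HasEigenvalue z})
    {p : Fin a → ℕ} (hp : ∀ i, p i = weyrIndex f (lam i))
    {α : Fin a → ℕ → ℕ} (hα : ∀ i, α i = weyrChar f (lam i)) :
    ∃ B : Module.Basis (Σ i : Fin a, BlockIdx (p i) (α i)) ℂ V,
      LinearMap.toMatrix B B f = weyrMatrix lam p α := by
  obtain rfl : p = fun i => weyrIndex f (lam i) := funext hp
  obtain rfl : α = fun i => weyrChar f (lam i) := funext hα
  choose b B hB h0 h1 using fun i => exists_basis_maxGenEigenspace f (lam i)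
  have hint := isInternal_maxGenEigenspace f hlam hrange
  refine ⟨hint.collectedBasis B, ?_⟩
  set C := hint.collectedBasis B with hC
  have hCb : ∀ i c u (hc : c < weyrIndex f (lam i)) (hu : u < weyrChar f (lam i) (c + 1)),
      C ⟨i, ⟨c, hc⟩, ⟨u, hu⟩⟩ = b i c u := by
    intro i c u hc hu
    rw [hC, DirectSum.IsInternal.collectedBasis_coe]
    exact hB i _
  ext x ⟨i, ⟨c, hc⟩, ⟨u, hu⟩⟩
  rw [LinearMap.toMatrix_apply, hCb, weyrMatrix_apply]
  cases c with
  | zero =>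
    rw [h0 i u hu, ← hCb i 0 u hc hu, map_smul, C.repr_self, Finsupp.smul_apply,
      Finsupp.single_apply, if_neg (c := _ ∧ _)]
    · by_cases hx : ⟨i, ⟨0, hc⟩, ⟨u, hu⟩⟩ = x
      · rw [if_pos hx, if_pos hx.symm, ← hx]
        simp
      · rw [if_neg hx, if_neg (Ne.symm hx)]
        simp
    · rintro ⟨-, h, -⟩
      simp at h
  | succ c =>
    have hu' : u < weyrChar f (lam i) (c + 1) :=
      hu.trans_le ((isWeyrSeq_weyrChar f (lam i)).antitone _ (Nat.succ_pos c))
    rw [h1 i c u hu, ← hCb i (c + 1) u hc hu, ← hCb i c u ((Nat.lt_succ_self c).trans hc) hu', map_add, map_smul,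
      C.repr_self, C.repr_self, Finsupp.add_apply, Finsupp.smul_apply, Finsupp.single_apply,
      Finsupp.single_apply]
    congr 1
    · by_cases hx : ⟨i, ⟨c + 1, hc⟩, ⟨u, hu⟩⟩ = x
      · rw [if_pos hx, if_pos hx.symm, ← hx]
        simp
      · rw [if_neg hx, if_neg (Ne.symm hx)]
        simp
    · refine if_congr ?_ rfl rfl
      rw [sigma_ext_iff]
      simp only [eq_comm, Nat.add_right_cancel_iff]

theorem exists_eigenvalue_enumeration (f : Module.End ℂ V) :
    ∃ (a : ℕ) (lam : Fin a → ℂ), Function.Injective lam ∧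
      Set.range lam = {z | f.HasEigenvalue z} := by
  have hfin : Finite {z | f.HasEigenvalue z} := inferInstanceAs (Finite f.Eigenvalues)
  obtain ⟨a, ⟨e⟩⟩ := Finite.exists_equiv_fin {z | f.HasEigenvalue z}
  refine ⟨a, fun i => (e.symm i : ℂ), Subtype.val_injective.comp e.symm.injective, ?_⟩
  rw [Set.range_comp' Subtype.val, e.symm.surjective.range_eq, Set.image_univ, Subtype.range_coe]

/-- Operators with equal nullities are similar. -/
theorem similarOps_of_nullity_eq {f g : Module.End ℂ V}
    (h : ∀ z k, nullity f z k = nullity g z k) : SimilarOps f g := by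
  have hev : {z | f.HasEigenvalue z} = {z | g.HasEigenvalue z} := by
    ext z
    rw [Set.mem_ofPred_eq, Set.mem_ofPred_eq, ← nullity_one_pos_iff, ← nullity_one_pos_iff, h]
  have hidx : ∀ z, weyrIndex f z = weyrIndex g z := by
    intro z
    simp only [weyrIndex, h]
  have hchar : ∀ z, weyrChar f z = weyrChar g z := by
    intro z
    funext k
    rw [weyrChar_eq, weyrChar_eq, h, h]
  obtain ⟨a, lam, hlam, hrange⟩ := exists_eigenvalue_enumeration f
  obtain ⟨B, hB⟩ := exists_basis_toMatrix_eq_weyrMatrix f hlam hrange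
    (p := fun i => weyrIndex f (lam i)) (fun _ => rfl)
    (α := fun i => weyrChar f (lam i)) (fun _ => rfl)
  obtain ⟨C, hC⟩ := exists_basis_toMatrix_eq_weyrMatrix g hlam (hrange.trans hev)
    (p := fun i => weyrIndex f (lam i)) (fun i => hidx _)
    (α := fun i => weyrChar f (lam i)) (fun i => hchar _)
  -- Both operators have the same Weyr matrix, in the bases `B` and `C`, so sending `B` to `C`
  -- intertwines them.
  refine ⟨B.equiv C (Equiv.refl _), fun v => ?_⟩
  have hlin : (B.equiv C (Equiv.refl _)).toLinearMap ∘ₗ f =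
      g ∘ₗ (B.equiv C (Equiv.refl _)).toLinearMap := by
    refine B.ext fun y => ?_
    simp only [LinearMap.comp_apply, LinearEquiv.coe_coe, Module.Basis.equiv_apply,
      Equiv.refl_apply]
    refine C.ext_elem fun x => ?_
    have h1 : C.repr (g (C y)) x = weyrMatrix lam _ _ x y := by
      rw [← hC, LinearMap.toMatrix_apply]
    have h2 : B.repr (f (B y)) x = weyrMatrix lam _ _ x y := by
      rw [← hB, LinearMap.toMatrix_apply]
    rw [h1, ← h2]
    simp [Module.Basis.equiv]
  exact LinearMap.congr_fun hlin v

end linearAlgebra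


/-! ### Nullities as a similarity invariant -/

section similarity

variable {V W : Type*} [AddCommGroup V] [Module ℂ V] [AddCommGroup W] [Module ℂ W]

theorem finrank_ker_pow_of_conj {f : Module.End ℂ V} {g : Module.End ℂ W} (T : V ≃ₗ[ℂ] W)
    (h : ∀ v, T (f v) = g (T v)) (k : ℕ) :
    Module.finrank ℂ (LinearMap.ker (f ^ k)) = Module.finrank ℂ (LinearMap.ker (g ^ k)) := by
  have hpow : ∀ v, T ((f ^ k) v) = (g ^ k) (T v) := by
    induction k with
    | zero => simp
    | succ k ih =>
      intro v
      rw [pow_succ', pow_succ', Module.End.mul_apply, Module.End.mul_apply, h, ih]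
  have hmap : (LinearMap.ker (f ^ k)).map (T : V →ₗ[ℂ] W) = LinearMap.ker (g ^ k) := by
    ext w
    rw [Submodule.mem_map_equiv, LinearMap.mem_ker, LinearMap.mem_ker, ← T.map_eq_zero_iff, hpow,
      T.apply_symm_apply]
  rw [← hmap, T.finrank_map_eq]

theorem SimilarOps.nullity_eq {f g : Module.End ℂ V} (h : SimilarOps f g) (z : ℂ) (k : ℕ) :
    nullity f z k = nullity g z k := by
  obtain ⟨T, hT⟩ := h
  refine finrank_ker_pow_of_conj T (fun v => ?_) k
  simp [hT]

variable [FiniteDimensional ℂ V]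

theorem exists_finset_sum_nullity (f : Module.End ℂ V) :
    ∃ S : Finset ℂ, (∀ z, z ∈ S ↔ f.HasEigenvalue z) ∧
      ∑ z ∈ S, nullity f z (Module.finrank ℂ V) = Module.finrank ℂ V := by
  obtain ⟨a, lam, hlam, hrange⟩ := exists_eigenvalue_enumeration f
  refine ⟨Finset.univ.map ⟨lam, hlam⟩, fun z => ?_, ?_⟩
  · have : z ∈ Set.range lam ↔ z ∈ {z | f.HasEigenvalue z} := by rw [hrange]
    simpa using this
  · have hint := isInternal_maxGenEigenspace f hlam hrange
    have h1 := (LinearEquiv.ofBijective (DirectSum.coeLinearMap _) hint).finrank_eq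
    rw [Module.finrank_directSum] at h1
    rw [Finset.sum_map]
    conv_rhs => rw [← h1]
    refine Finset.sum_congr rfl fun i _ => ?_
    change nullity f (lam i) _ = _
    rw [← ker_pow_weyrIndex]
    change _ = nullity f (lam i) _
    rcases le_total (Module.finrank ℂ V) (weyrIndex f (lam i)) with h | h
    · rw [nullity_eq_nullity_finrank _ _ h]
    · rw [nullity_eq_of_le (weyrIndex_spec f (lam i)).2 h]

/-- Powers beyond the dimension add nothing since nullities have stabilised. Eigenvalues of `f`
suffice because their generalized eigenspaces fill the space: with equal nullities those of `g` do
too, leaving no room for a further eigenvalue of `g`. -/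
theorem similarOps_iff {f g : Module.End ℂ V} :
    SimilarOps f g ↔ ∀ z, f.HasEigenvalue z → ∀ k, 1 ≤ k → k ≤ Module.finrank ℂ V →
      nullity f z k = nullity g z k := by
  refine ⟨fun h z _ k _ _ => h.nullity_eq z k, fun h => similarOps_of_nullity_eq fun z k => ?_⟩
  have hall : ∀ z, f.HasEigenvalue z → ∀ k, nullity f z k = nullity g z k := by
    intro z hz k
    have hle : ∀ k ≤ Module.finrank ℂ V, nullity f z k = nullity g z k := by
      intro k hk
      rcases Nat.eq_zero_or_pos k with rfl | hpos
      · rw [nullity_zero, nullity_zero]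
      · exact h z hz k hpos hk
    rcases le_total k (Module.finrank ℂ V) with hk | hk
    · exact hle k hk
    · rw [nullity_eq_nullity_finrank f z hk, nullity_eq_nullity_finrank g z hk, hle _ le_rfl]
  by_cases hz : f.HasEigenvalue z
  · exact hall z hz k
  rw [nullity_eq_zero hz]
  by_cases hz' : g.HasEigenvalue z
  · exfalso
    obtain ⟨S, hS, hSsum⟩ := exists_finset_sum_nullity f
    obtain ⟨S', hS', hSsum'⟩ := exists_finset_sum_nullity g
    have hsub : insert z S ⊆ S' := by
      intro y hy
      rcases Finset.mem_insert.mp hy with rfl | hy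
      · exact (hS' y).mpr hz'
      · have hy' := (hS y).mp hy
        rw [hS', ← nullity_one_pos_iff, ← hall y hy', nullity_one_pos_iff]
        exact hy'
    have h1 := Finset.sum_le_sum_of_subset (f := fun y => nullity g y (Module.finrank ℂ V)) hsub
    rw [Finset.sum_insert (fun hmem => hz ((hS z).mp hmem)), hSsum',
      ← Finset.sum_congr rfl fun y hy => hall y ((hS y).mp hy) _, hSsum] at h1
    have h2 := (nullity_one_pos_iff g z).mpr hz'
    have h3 : nullity g z 1 ≤ nullity g z (Module.finrank ℂ V) :=
      nullity_mono g z (Nat.pos_of_ne_zero fun h0 => by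
        have := nullity_le g z 1
        omega)
    omega
  · rw [nullity_eq_zero hz']

end similarity

/-! ### Reduction of `phi A B` to Weyr matrices -/

section phi

variable {m n m' n' : Type*} [Fintype m] [Fintype n] [Fintype m'] [Fintype n']

theorem phi_apply (A : Matrix m m ℂ) (B : Matrix n n ℂ) (X : Matrix m n ℂ) :
    phi A B X = A * X - X * B := rfl

theorem phi_sub_smul_one [DecidableEq m] (A : Matrix m m ℂ) (B : Matrix n n ℂ) (z : ℂ) :
    phi A B - z • (1 : Module.End ℂ (Matrix m n ℂ)) = phi (A - z • (1 : Matrix m m ℂ)) B := by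
  refine LinearMap.ext fun X => ?_
  rw [LinearMap.sub_apply, LinearMap.smul_apply, Module.End.one_apply, phi_apply, phi_apply,
    Matrix.sub_mul, Matrix.smul_mul, Matrix.one_mul]
  abel

theorem nullity_phi_eq [DecidableEq m] (A : Matrix m m ℂ) (B : Matrix n n ℂ) (z : ℂ) (k : ℕ) :
    nullity (phi A B) z k =
      Module.finrank ℂ (LinearMap.ker (phi (A - z • (1 : Matrix m m ℂ)) B ^ k)) := by
  rw [nullity, phi_sub_smul_one]

theorem finrank_ker_phi_pow_of_similar [DecidableEq m] [DecidableEq n] [DecidableEq m']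
    [DecidableEq n'] {A : Matrix m m ℂ} {B : Matrix n n ℂ} {A' : Matrix m' m' ℂ}
    {B' : Matrix n' n' ℂ} {P : Matrix m m' ℂ} {P' : Matrix m' m ℂ} {Q : Matrix n n' ℂ}
    {Q' : Matrix n' n ℂ} (hP : P * P' = 1) (hP' : P' * P = 1) (hQ : Q * Q' = 1)
    (hQ' : Q' * Q = 1) (hA : P' * A = A' * P') (hB : B * Q = Q * B') (k : ℕ) :
    Module.finrank ℂ (LinearMap.ker (phi A B ^ k)) =
      Module.finrank ℂ (LinearMap.ker (phi A' B' ^ k)) := by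
  let T : Matrix m n ℂ ≃ₗ[ℂ] Matrix m' n' ℂ :=
    { toFun := fun X => P' * X * Q
      invFun := fun Y => P * Y * Q'
      map_add' := fun X Y => by rw [Matrix.mul_add, Matrix.add_mul]
      map_smul' := fun c X => by simp
      left_inv := fun X => by
        calc P * (P' * X * Q) * Q' = (P * P') * X * (Q * Q') := by simp only [Matrix.mul_assoc]
          _ = X := by rw [hP, hQ, Matrix.one_mul, Matrix.mul_one]
      right_inv := fun Y => by
        calc P' * (P * Y * Q') * Q = (P' * P) * Y * (Q' * Q) := by simp only [Matrix.mul_assoc]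
          _ = Y := by rw [hP', hQ', Matrix.one_mul, Matrix.mul_one] }
  refine finrank_ker_pow_of_conj T (fun X => ?_) k
  change P' * (A * X - X * B) * Q = A' * (P' * X * Q) - P' * X * Q * B'
  rw [Matrix.mul_sub, Matrix.sub_mul, ← Matrix.mul_assoc P' A, hA]
  simp only [Matrix.mul_assoc, hB]

theorem finrank_ker_phi_pow_submatrix (e : m' ≃ m) (e' : n' ≃ n) (A : Matrix m m ℂ)
    (B : Matrix n n ℂ) (k : ℕ) :
    Module.finrank ℂ (LinearMap.ker (phi A B ^ k)) =
      Module.finrank ℂ (LinearMap.ker (phi (A.submatrix e e) (B.submatrix e' e') ^ k)) := by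
  refine finrank_ker_pow_of_conj (Matrix.reindexLinearEquiv ℂ ℂ e.symm e'.symm) (fun X => ?_) k
  change (A * X - X * B).submatrix e e' =
    A.submatrix e e * X.submatrix e e' - X.submatrix e e' * B.submatrix e' e'
  rw [Matrix.submatrix_mul_equiv, Matrix.submatrix_mul_equiv]
  rfl

end phi

theorem weyrMatrix_sub_smul_one {a : ℕ} (lam : Fin a → ℂ) (p : Fin a → ℕ) (α : Fin a → ℕ → ℕ)
    (z : ℂ) : weyrMatrix lam p α - z • (1 : Matrix _ _ ℂ) = weyrMatrix (fun i => lam i - z) p α := by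
  ext x y
  rw [Matrix.sub_apply, Matrix.smul_apply, weyrMatrix_apply, weyrMatrix_apply, Matrix.one_apply]
  by_cases h : x = y
  · simp only [if_pos h, smul_eq_mul]
    ring
  · simp only [if_neg h, smul_eq_mul]
    ring

/-- Reduction of a square matrix to Weyr form. -/
theorem exists_similar_weyrMatrix {m a : ℕ} (A : Matrix (Fin m) (Fin m) ℂ) {lam : Fin a → ℂ}
    (hlam : Function.Injective lam)
    (hrange : Set.range lam = {z | Module.End.HasEigenvalue (Matrix.toLin' A) z})
    {p : Fin a → ℕ} (hp : ∀ i, p i = weyrIndex (Matrix.toLin' A) (lam i))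
    {α : Fin a → ℕ → ℕ} (hα : ∀ i, α i = weyrChar (Matrix.toLin' A) (lam i)) :
    ∃ (P : Matrix (Fin m) (Σ i : Fin a, BlockIdx (p i) (α i)) ℂ)
      (P' : Matrix (Σ i : Fin a, BlockIdx (p i) (α i)) (Fin m) ℂ),
      P * P' = 1 ∧ P' * P = 1 ∧ P' * A = weyrMatrix lam p α * P' ∧
        A * P = P * weyrMatrix lam p α := by
  obtain ⟨b, hb⟩ := exists_basis_toMatrix_eq_weyrMatrix (Matrix.toLin' A) hlam hrange hp hα
  set s := Pi.basisFun ℂ (Fin m)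
  have hA : LinearMap.toMatrix s s (Matrix.toLin' A) = A := LinearMap.toMatrix'_toLin' A
  refine ⟨s.toMatrix b, b.toMatrix s, s.toMatrix_mul_toMatrix_flip b, b.toMatrix_mul_toMatrix_flip s,
    ?_, ?_⟩
  · rw [← hb]
    conv_lhs => rw [← hA]
    rw [basis_toMatrix_mul_linearMap_toMatrix, linearMap_toMatrix_mul_basis_toMatrix]
  · rw [← hb]
    conv_lhs => rw [← hA]
    rw [basis_toMatrix_mul_linearMap_toMatrix, linearMap_toMatrix_mul_basis_toMatrix]

/-! ### Arithmetic of the dimension and Weyr numbers -/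

theorem dimNumber_zero (p q : ℕ) (γ δ : ℕ → ℕ) : dimNumber p q γ δ 0 = 0 := by
  simp [dimNumber]

theorem weyrNumber_succ (p q : ℕ) (γ δ : ℕ → ℕ) (k : ℕ) :
    weyrNumber p q γ δ (k + 1) = dimNumber p q γ δ (k + 1) - dimNumber p q γ δ k := by
  have h1 : ∀ l, (γ (1 + l) : ℤ) * ∑ s ∈ Finset.Icc 1 (k + 1), (δ (s + l) : ℤ) =
      (γ (1 + l) : ℤ) * ∑ s ∈ Finset.Icc 1 k, (δ (s + l) : ℤ) +
        (γ (1 + l) : ℤ) * (δ (k + 1 + l) : ℤ) := by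
    intro l
    rw [Finset.sum_Icc_succ_top (by omega), mul_add]
  rw [weyrNumber, Finset.sum_add_distrib, Finset.sum_comm, dimNumber, dimNumber]
  simp only [h1, Finset.sum_add_distrib]
  rcases Nat.eq_zero_or_pos k with rfl | hk
  · simp
  · have h2 : ∀ r ∈ Finset.Icc 2 k, ∑ l ∈ Finset.range (min p q + 1),
          (γ (r + l) : ℤ) * ((δ (1 + (k + 1) - r + l) : ℤ) - (δ (2 + (k + 1) - r + l) : ℤ)) =
        ∑ l ∈ Finset.range (min p q + 1),
          (γ (r + l) : ℤ) * ((δ (1 + l) : ℤ) - (δ (2 + (k + 1) - r + l) : ℤ)) -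
        ∑ l ∈ Finset.range (min p q + 1),
          (γ (r + l) : ℤ) * ((δ (1 + l) : ℤ) - (δ (2 + k - r + l) : ℤ)) := by
      intro r _
      rw [← Finset.sum_sub_distrib]
      refine Finset.sum_congr rfl fun l _ => ?_
      rw [show 1 + (k + 1) - r + l = 2 + k - r + l by omega]
      ring
    rw [Finset.sum_Icc_succ_top (by omega), Finset.sum_Icc_succ_top (by omega),
      Finset.sum_congr rfl h2, Finset.sum_sub_distrib]
    simp only [show 1 + (k + 1) - (k + 1) = 1 by omega]
    ring

namespace IsWeyrSeq

variable {p q : ℕ} {γ δ : ℕ → ℕ}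

theorem weyrNumber_summand_nonneg (hδ : IsWeyrSeq q δ) {k r : ℕ} (hr : r ∈ Finset.Icc 2 k)
    (l : ℕ) :
    0 ≤ (γ (r + l) : ℤ) * ((δ (1 + k - r + l) : ℤ) - (δ (2 + k - r + l) : ℤ)) := by
  have := Finset.mem_Icc.mp hr
  have hle : δ (2 + k - r + l) ≤ δ (1 + k - r + l) := hδ.le (by omega) (by omega)
  exact mul_nonneg (by positivity) (sub_nonneg.mpr (by exact_mod_cast hle))

theorem weyrNumber_nonneg (hδ : IsWeyrSeq q δ) (k : ℕ) : 0 ≤ weyrNumber p q γ δ k :=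
  Finset.sum_nonneg fun l _ => add_nonneg (by positivity)
    (Finset.sum_nonneg fun _ hr => hδ.weyrNumber_summand_nonneg hr l)

theorem weyrNumber_pos (hγ : IsWeyrSeq p γ) (hδ : IsWeyrSeq q δ) (hp : 0 < γ p) (hq : 0 < δ q) :
    0 < weyrNumber p q γ δ (p + q - 1) := by
  have hp1 := hγ.one_le
  have hq1 := hδ.one_le
  have hpq : (0 : ℤ) < γ p * δ q := by positivity
  refine lt_of_lt_of_le ?_ (Finset.single_le_sum (f := fun l => (γ (1 + l) : ℤ) *
    (δ (p + q - 1 + l) : ℤ) + ∑ r ∈ Finset.Icc 2 (p + q - 1), (γ (r + l) : ℤ) *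
      ((δ (1 + (p + q - 1) - r + l) : ℤ) - (δ (2 + (p + q - 1) - r + l) : ℤ)))
    (fun l _ => add_nonneg (by positivity)
      (Finset.sum_nonneg fun _ hr => hδ.weyrNumber_summand_nonneg hr l))
    (Finset.mem_range.mpr (Nat.succ_pos _) : 0 ∈ Finset.range (min p q + 1)))
  -- The surviving term is `γ p * δ q` at `l = 0`. It is the summand `r = p`, except that for `p =
  -- 1` the sum over `r ≥ 2` misses it and the separate first term provides it.
  by_cases h : p = 1
  · subst h
    refine add_pos_of_pos_of_nonneg ?_
      (Finset.sum_nonneg fun _ hr => hδ.weyrNumber_summand_nonneg hr 0)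
    simpa using hpq
  · refine add_pos_of_nonneg_of_pos (by positivity) ?_
    refine lt_of_lt_of_le ?_ (Finset.single_le_sum (f := fun r => (γ (r + 0) : ℤ) *
      ((δ (1 + (p + q - 1) - r + 0) : ℤ) - (δ (2 + (p + q - 1) - r + 0) : ℤ)))
      (fun _ hr => hδ.weyrNumber_summand_nonneg hr 0)
      (Finset.mem_Icc.mpr ⟨by omega, by omega⟩ : p ∈ Finset.Icc 2 (p + q - 1)))
    simp only [add_zero]
    rw [show 1 + (p + q - 1) - p = q by omega, hδ.eq_zero (2 + (p + q - 1) - p) (by omega)]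
    simpa using hpq

theorem weyrNumber_eq_zero (hγ : IsWeyrSeq p γ) (hδ : IsWeyrSeq q δ) {k : ℕ} (hk : p + q ≤ k) :
    weyrNumber p q γ δ k = 0 := by
  have hp1 := hγ.one_le
  refine Finset.sum_eq_zero fun l _ => ?_
  rw [hδ.eq_zero (k + l) (by omega), Nat.cast_zero, mul_zero, zero_add]
  refine Finset.sum_eq_zero fun r hr => ?_
  -- Since `p + q ≤ k`, either `r` exceeds `p` or `1 + k - r` exceeds `q`.
  by_cases h : p < r
  · rw [hγ.eq_zero (r + l) (by omega), Nat.cast_zero, zero_mul]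
  · rw [hδ.eq_zero (1 + k - r + l) (by omega), hδ.eq_zero (2 + k - r + l) (by omega), sub_self,
      mul_zero]

theorem finrank_ker_phi_weyrNilpotent (hγ : IsWeyrSeq p γ) (hδ : IsWeyrSeq q δ) {k : ℕ}
    (hk : 1 ≤ k) :
    (Module.finrank ℂ (LinearMap.ker (phi (weyrNilpotent p γ) (weyrNilpotent q δ) ^ k)) : ℤ) =
      dimNumber p q γ δ k := by
  -- A single nilpotent block is a Weyr matrix with one eigenvalue `0`, so the general count
  -- specialises to it.
  have hN : ∀ (p : ℕ) (γ : ℕ → ℕ),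
      (weyrNilpotent p γ).submatrix (Equiv.uniqueSigma fun _ : Fin 1 => BlockIdx p γ)
        (Equiv.uniqueSigma fun _ : Fin 1 => BlockIdx p γ) =
      weyrMatrix (fun _ : Fin 1 => 0) (fun _ => p) (fun _ => γ) := by
    intro p γ
    ext ⟨i, x⟩ ⟨j, y⟩
    obtain rfl := Subsingleton.elim i j
    rw [weyrMatrix_apply]
    simp [weyrNilpotent, Equiv.uniqueSigma]
  rw [finrank_ker_phi_pow_submatrix (Equiv.uniqueSigma fun _ : Fin 1 => BlockIdx p γ)
    (Equiv.uniqueSigma fun _ : Fin 1 => BlockIdx q δ), hN, hN,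
    finrank_ker_phi_weyrMatrix (fun _ => hγ) (fun _ => hδ) hk]
  simp

end IsWeyrSeq

/-! ### Spectrum, Weyr characteristic and index of `phi A B` -/

section spectrum

variable {m n a b : ℕ} {A : Matrix (Fin m) (Fin m) ℂ} {B : Matrix (Fin n) (Fin n) ℂ}
  {lam : Fin a → ℂ} {mu : Fin b → ℂ} {p : Fin a → ℕ} {q : Fin b → ℕ}
  {α : Fin a → ℕ → ℕ} {β : Fin b → ℕ → ℕ}

theorem nullity_phi (hlam : Function.Injective lam)
    (hlamA : Set.range lam = {z | Module.End.HasEigenvalue (Matrix.toLin' A) z})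
    (hmu : Function.Injective mu)
    (hmuB : Set.range mu = {z | Module.End.HasEigenvalue (Matrix.toLin' B) z})
    (hp : ∀ i, p i = weyrIndex (Matrix.toLin' A) (lam i))
    (hq : ∀ j, q j = weyrIndex (Matrix.toLin' B) (mu j))
    (hα : ∀ i, α i = weyrChar (Matrix.toLin' A) (lam i))
    (hβ : ∀ j, β j = weyrChar (Matrix.toLin' B) (mu j)) (z : ℂ) (k : ℕ) :
    (nullity (phi A B) z k : ℤ) =
      ∑ i, ∑ j, if lam i - z = mu j then dimNumber (p i) (q j) (α i) (β j) k else 0 := by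
  rcases Nat.eq_zero_or_pos k with rfl | hk
  · simp [nullity_zero, dimNumber_zero]
  obtain ⟨P, P', hP, hP', hAP, -⟩ := exists_similar_weyrMatrix A hlam hlamA hp hα
  obtain ⟨Q, Q', hQ, hQ', -, hBQ⟩ := exists_similar_weyrMatrix B hmu hmuB hq hβ
  have hAz : P' * (A - z • (1 : Matrix (Fin m) (Fin m) ℂ)) =
      weyrMatrix (fun i => lam i - z) p α * P' := by
    rw [← weyrMatrix_sub_smul_one, Matrix.mul_sub, Matrix.sub_mul, hAP]
    simp
  rw [nullity_phi_eq, finrank_ker_phi_pow_of_similar hP hP' hQ hQ' hAz hBQ]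
  refine finrank_ker_phi_weyrMatrix (fun i => ?_) (fun j => ?_) hk _ _
  · rw [hp, hα]
    exact isWeyrSeq_weyrChar _ _
  · rw [hq, hβ]
    exact isWeyrSeq_weyrChar _ _

theorem weyrChar_phi (hnull : ∀ z k, (nullity (phi A B) z k : ℤ) =
      ∑ i, ∑ j, if lam i - z = mu j then dimNumber (p i) (q j) (α i) (β j) k else 0)
    (z : ℂ) {k : ℕ} (hk : 1 ≤ k) :
    (weyrChar (phi A B) z k : ℤ) =
      ∑ i, ∑ j, if lam i - z = mu j then weyrNumber (p i) (q j) (α i) (β j) k else 0 := by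
  obtain ⟨k, rfl⟩ : ∃ k', k = k' + 1 := ⟨k - 1, by omega⟩
  rw [weyrChar_eq, Nat.cast_sub (nullity_mono _ _ (Nat.sub_le _ _)), Nat.add_sub_cancel, hnull,
    hnull, ← Finset.sum_sub_distrib]
  refine Finset.sum_congr rfl fun i _ => ?_
  rw [← Finset.sum_sub_distrib]
  refine Finset.sum_congr rfl fun j _ => ?_
  split_ifs
  · rw [weyrNumber_succ]
  · rw [sub_zero]

/-- No contribution is negative, so the positive one of the pair `(i, j)` at `p i + q j - 1` cannot
cancel. -/
theorem le_weyrIndex_phi (hα : ∀ i, IsWeyrSeq (p i) (α i)) (hβ : ∀ j, IsWeyrSeq (q j) (β j))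
    (hαpos : ∀ i, 0 < α i (p i)) (hβpos : ∀ j, 0 < β j (q j))
    (hchar : ∀ z k, 1 ≤ k → (weyrChar (phi A B) z k : ℤ) =
      ∑ i, ∑ j, if lam i - z = mu j then weyrNumber (p i) (q j) (α i) (β j) k else 0)
    (i : Fin a) (j : Fin b) :
    0 < weyrChar (phi A B) (lam i - mu j) (p i + q j - 1) ∧
      p i + q j - 1 ≤ weyrIndex (phi A B) (lam i - mu j) := by
  have hk : 1 ≤ p i + q j - 1 := by
    have := (hα i).one_le
    have := (hβ j).one_le
    omega
  have hnonneg : ∀ i' j', (0 : ℤ) ≤ if lam i' - (lam i - mu j) = mu j' then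
      weyrNumber (p i') (q j') (α i') (β j') (p i + q j - 1) else 0 := by
    intro i' j'
    split_ifs
    · exact (hβ j').weyrNumber_nonneg _
    · exact le_rfl
  have hpos : 0 < weyrChar (phi A B) (lam i - mu j) (p i + q j - 1) := by
    rw [← Nat.cast_pos (α := ℤ), hchar _ _ hk]
    refine Finset.sum_pos' (fun i' _ => Finset.sum_nonneg fun j' _ => hnonneg i' j')
      ⟨i, Finset.mem_univ i, Finset.sum_pos' (fun j' _ => hnonneg i j') ⟨j, Finset.mem_univ j, ?_⟩⟩
    rw [if_pos (by ring)]
    exact (hα i).weyrNumber_pos (hβ j) (hαpos i) (hβpos j)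
  refine ⟨hpos, ?_⟩
  by_contra hcon
  rw [weyrChar, if_neg hcon] at hpos
  exact lt_irrefl _ hpos

/-- The Weyr number at the index of an eigenvalue is nonzero, so some pair contributes to it, and a
pair contributes nothing from `p i + q j` on. -/
theorem weyrIndex_phi_le (hα : ∀ i, IsWeyrSeq (p i) (α i)) (hβ : ∀ j, IsWeyrSeq (q j) (β j))
    (hchar : ∀ z k, 1 ≤ k → (weyrChar (phi A B) z k : ℤ) =
      ∑ i, ∑ j, if lam i - z = mu j then weyrNumber (p i) (q j) (α i) (β j) k else 0)
    {z : ℂ} (hz : Module.End.HasEigenvalue (phi A B) z) :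
    ∃ i j, lam i - mu j = z ∧ weyrIndex (phi A B) z ≤ p i + q j - 1 := by
  have hpos := weyrChar_weyrIndex_pos hz
  rw [← Nat.cast_pos (α := ℤ), hchar _ _ (weyrIndex_spec _ _).1] at hpos
  obtain ⟨i, -, hi⟩ := Finset.exists_ne_zero_of_sum_ne_zero hpos.ne'
  obtain ⟨j, -, hj⟩ := Finset.exists_ne_zero_of_sum_ne_zero hi
  rw [ite_ne_right_iff] at hj
  refine ⟨i, j, by rw [← hj.1]; ring, ?_⟩
  by_contra hcon
  exact hj.2 ((hα i).weyrNumber_eq_zero (hβ j) (by omega))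

end spectrum

end WeyrKernel

end

/-! ### Assembly of the theorem -/

theorem theorem1p1 {m n a b : ℕ}
    (A : Matrix (Fin m) (Fin m) ℂ) (B : Matrix (Fin n) (Fin n) ℂ)
    -- the distinct eigenvalues of `A` and of `B`
    (lam : Fin a → ℂ) (hlam : Function.Injective lam)
    (hlamA : Set.range lam = {z | Module.End.HasEigenvalue (Matrix.toLin' A) z})
    (mu : Fin b → ℂ) (hmu : Function.Injective mu)
    (hmuB : Set.range mu = {z | Module.End.HasEigenvalue (Matrix.toLin' B) z})
    -- their indices and Weyr characteristics
    (p : Fin a → ℕ) (hp : ∀ i, p i = WeyrKernel.weyrIndex (Matrix.toLin' A) (lam i))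
    (q : Fin b → ℕ) (hq : ∀ j, q j = WeyrKernel.weyrIndex (Matrix.toLin' B) (mu j))
    (α : Fin a → ℕ → ℕ) (hα : ∀ i, α i = WeyrKernel.weyrChar (Matrix.toLin' A) (lam i))
    (β : Fin b → ℕ → ℕ) (hβ : ∀ j, β j = WeyrKernel.weyrChar (Matrix.toLin' B) (mu j)) :
    -- the dimension of the kernel of each power
    (∀ k : ℕ, 1 ≤ k →
      Module.finrank ℂ (LinearMap.ker (WeyrKernel.phi A B ^ k)) =
          ∑ i, ∑ j, (if lam i = mu j then
            Module.finrank ℂ (LinearMap.ker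
              (WeyrKernel.phi (WeyrKernel.weyrNilpotent (p i) (α i))
                (WeyrKernel.weyrNilpotent (q j) (β j)) ^ k)) else 0) ∧
      (Module.finrank ℂ (LinearMap.ker (WeyrKernel.phi A B ^ k)) : ℤ) =
          ∑ i, ∑ j, (if lam i = mu j then
            WeyrKernel.dimNumber (p i) (q j) (α i) (β j) k else 0)) ∧
    -- the coefficients in the basis are well defined
    (∀ k : ℕ, 1 ≤ k → ∀ i j r s l, lam i = mu j →
      WeyrKernel.AdmissibleRSL (p i) (q j) k r s l →
      ∀ Q : ℕ, q j ≤ Q → k + l + s ≤ Q + r →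
        ∃! x : Fin (l + 1) → ℂ, WeyrKernel.SolvesCoeff (p i) Q (k - 1) r s l x) ∧
    -- the basis of the kernel of each power for the Weyr matrices
    (∀ k : ℕ, 1 ≤ k → ∀ x : Fin a → Fin b → ℕ → ℕ → (l : ℕ) → Fin (l + 1) → ℂ,
      (∀ i j r s l, lam i = mu j → WeyrKernel.AdmissibleRSL (p i) (q j) k r s l →
        ∃ Q : ℕ, q j ≤ Q ∧ k + l + s ≤ Q + r ∧
          WeyrKernel.SolvesCoeff (p i) Q (k - 1) r s l (x i j r s l)) →
      LinearIndependent ℂ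
          (fun L : WeyrKernel.labelSet lam mu p q α β k =>
            WeyrKernel.kernelElement p q α β x (L : WeyrKernel.Label a b)) ∧
      Submodule.span ℂ
          (WeyrKernel.kernelElement p q α β x '' WeyrKernel.labelSet lam mu p q α β k) =
        LinearMap.ker (WeyrKernel.phi (WeyrKernel.weyrMatrix lam p α)
          (WeyrKernel.weyrMatrix mu q β) ^ k)) ∧
    -- the eigenvalues
    {z | Module.End.HasEigenvalue (WeyrKernel.phi A B) z} = {z | ∃ i j, z = lam i - mu j} ∧
    -- the Weyr characteristic and the index of each eigenvalue
    (∀ z : ℂ, Module.End.HasEigenvalue (WeyrKernel.phi A B) z →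
      (∀ k : ℕ, 1 ≤ k →
        (WeyrKernel.weyrChar (WeyrKernel.phi A B) z k : ℤ) =
          ∑ i, ∑ j, (if lam i - z = mu j then
            WeyrKernel.weyrNumber (p i) (q j) (α i) (β j) k else 0)) ∧
      IsGreatest {N : ℕ | ∃ i j, lam i - mu j = z ∧ N = p i + q j - 1}
        (WeyrKernel.weyrIndex (WeyrKernel.phi A B) z)) ∧
    -- the kernel dimensions determine the operator up to similarity
    (∀ (C : Matrix (Fin m) (Fin m) ℂ) (D : Matrix (Fin n) (Fin n) ℂ),
      WeyrKernel.SimilarOps (WeyrKernel.phi A B) (WeyrKernel.phi C D) ↔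
        ∀ z : ℂ, Module.End.HasEigenvalue (WeyrKernel.phi A B) z →
          ∀ k : ℕ, 1 ≤ k → k ≤ m * n →
            Module.finrank ℂ (LinearMap.ker
                (WeyrKernel.phi (A - z • (1 : Matrix (Fin m) (Fin m) ℂ)) B ^ k)) =
              Module.finrank ℂ (LinearMap.ker
                (WeyrKernel.phi (C - z • (1 : Matrix (Fin m) (Fin m) ℂ)) D ^ k))) := by
  open WeyrKernel in
  have hαW : ∀ i, IsWeyrSeq (p i) (α i) := fun i => by
    rw [hp, hα]
    exact isWeyrSeq_weyrChar _ _
  have hβW : ∀ j, IsWeyrSeq (q j) (β j) := fun j => by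
    rw [hq, hβ]
    exact isWeyrSeq_weyrChar _ _
  have hαpos : ∀ i, 0 < α i (p i) := fun i => by
    rw [hp, hα]
    exact weyrChar_weyrIndex_pos (hlamA.subset ⟨i, rfl⟩)
  have hβpos : ∀ j, 0 < β j (q j) := fun j => by
    rw [hq, hβ]
    exact weyrChar_weyrIndex_pos (hmuB.subset ⟨j, rfl⟩)
  have hnull := nullity_phi hlam hlamA hmu hmuB hp hq hα hβ
  have hchar : ∀ z k, 1 ≤ k → (weyrChar (phi A B) z k : ℤ) =
      ∑ i, ∑ j, if lam i - z = mu j then weyrNumber (p i) (q j) (α i) (β j) k else 0 :=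
    fun z k hk => weyrChar_phi hnull z hk
  have hindex := le_weyrIndex_phi hαW hβW hαpos hβpos hchar
  have hsolves : ∀ k, 1 ≤ k → ∀ i j r s l, AdmissibleRSL (p i) (q j) k r s l → ∀ Q, q j ≤ Q →
      k + l + s ≤ Q + r → ∀ x : Fin (l + 1) → ℂ,
        (SolvesCoeff (p i) Q (k - 1) r s l x ↔ SolvesWindow (k - 1) (k - r) l x) := by
    intro k hk i j r s l hadm Q hQ hkQ x
    obtain ⟨hr, hs, hrs, hrk, hrl, hsl⟩ := hadm.bounds (hαW i).one_le (hβW j).one_le hk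
    rw [solvesCoeff_iff hr hs hrs (by omega) hrl (by omega) (by omega), Nat.sub_add_cancel hk]
  refine ⟨fun k hk => ?_, ?_, ?_, ?_, fun z hz => ⟨fun k hk => hchar z k hk, ?_⟩, fun C D => ?_⟩
  · have h := hnull 0 k
    rw [nullity_phi_eq, zero_smul, sub_zero] at h
    simp only [sub_zero] at h
    refine ⟨?_, h⟩
    rw [← Nat.cast_inj (R := ℤ), h, Nat.cast_sum]
    refine Finset.sum_congr rfl fun i _ => ?_
    rw [Nat.cast_sum]
    refine Finset.sum_congr rfl fun j _ => ?_
    rw [Nat.cast_ite, (hαW i).finrank_ker_phi_weyrNilpotent (hβW j) hk, Nat.cast_zero]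
  · intro k hk i j r s l _ hadm Q hQ hkQ
    have hr := (hadm.bounds (hαW i).one_le (hβW j).one_le hk).1
    simp only [hsolves k hk i j r s l hadm Q hQ hkQ]
    exact existsUnique_solvesWindow (by omega) l
  · intro k hk x hx
    have hx' : ∀ i j r s l, lam i = mu j → AdmissibleRSL (p i) (q j) k r s l →
        SolvesWindow (k - 1) (k - r) l (x i j r s l) := by
      intro i j r s l hlm hadm
      obtain ⟨Q, hQ, hkQ, h⟩ := hx i j r s l hlm hadm
      exact (hsolves k hk i j r s l hadm Q hQ hkQ _).mp h
    exact ⟨linearIndependent_kernelElement hαW hβW hk hx', (span_kernelElement hαW hβW hk hx').1⟩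
  · ext z
    constructor
    · intro hz
      obtain ⟨i, j, h, -⟩ := weyrIndex_phi_le hαW hβW hchar hz
      exact ⟨i, j, h.symm⟩
    · rintro ⟨i, j, rfl⟩
      -- At a number that is not an eigenvalue all nullities are zero, which contradicts the
      -- positive Weyr number supplied by `hindex`.
      by_contra hz
      have := (hindex i j).1
      rw [weyrChar_eq, nullity_eq_zero hz, Nat.zero_sub] at this
      exact lt_irrefl _ this
  · constructor
    · obtain ⟨i, j, h, hle⟩ := weyrIndex_phi_le hαW hβW hchar hz
      subst h
      exact ⟨i, j, rfl, le_antisymm hle (hindex i j).2⟩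
    · rintro N ⟨i, j, rfl, rfl⟩
      exact (hindex i j).2
  · rw [similarOps_iff, Module.finrank_matrix, Module.finrank_self, mul_one, Fintype.card_fin,
      Fintype.card_fin]
    simp only [nullity_phi_eq]
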